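/- Let $\Gamma$ be a group and $\Gamma'=\{\Gamma_i\}_{i\in I}$ a finite non-empty family of subgroups (repetitions allowed). Relative hyperbolicity. A finite symmetric generating set $S\not\ni 1$ of $\Gamma$ is compatible if $S\cap\Gamma_i$ generates $\Gamma_i$ for every $i$. The combinatorial horoball on a graph $G$ has vertex set $G^{(0)}\times\mathbb N$ and the following edges: the vertices of height $0$ span a copy of $G$; $(g,n)$ is joined to $(g,n+1)$ for all $n\ge 0$; for $n\ge 1$ and $g\neq h$, $(g,n)$ is joined to $(h,n)$ if and only if $d_G(g,h)\le 2^n$. The cusped graph of $(\Gamma,\Gamma')$ with respect to $S$ is obtained from the simplicial Cayley graph of $\Gamma$ (with $g,h$ joined iff $g^{-1}h\in S$) by gluing, for every $i\in I$ and every coset $g\Gamma_i$, along the vertices in $g\Gamma_i$ the horoball on the full subgraph with vertex set $g\Gamma_i$. The pair $(\Gamma,\Gamma')$ is relatively hyperbolic if there is a compatible finite generating set $S$ for which the cusped graph, with its graph metric, is Gromov hyperbolic (in particular $\Gamma$ and all $\Gamma_i$ are finitely generated). Relative cohomology. Let $\mathrm{St}_k$ be the real vector space with basis $(\Gamma\times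 I)^{k+1}$, with boundary $\partial(x_0,\dots,x_k)=\sum_{j=0}^k(-1)^j(x_0,\dots,\hat x_j,\dots,x_k)$ and with $\Gamma$ acting by left translation on the $\Gamma$-coordinates. Let $\mathrm{St}'_k\subseteq\mathrm{St}_k$ be spanned by the tuples whose entries all lie in $g\Gamma_i\times\{i\}$ for some $i\in I$ and $g\in\Gamma$, and let $\mathrm{St}^{\mathrm{rel}}_*=\mathrm{St}_*/\mathrm{St}'_*$. For a $\Gamma$-module $V$ (a real vector space with a linear $\Gamma$-action), $H^k(\Gamma,\Gamma';V)$ is the $k$-th cohomology of the cochain complex $\mathrm{Hom}^\Gamma(\mathrm{St}^{\mathrm{rel}}_*,V)$ of $\Gamma$-equivariant linear maps. A bounded $\Gamma$-module is a real normed space $V$ with a linear $\Gamma$-action for which there is $L>0$ with $\|\gamma v\|\le L\|v\|$ for all $\gamma\in\Gamma$, $v\in V$. Theorem. If $(\Gamma,\Gamma')$ is relatively hyperbolic, then there is $n\in\mathbb N$ such that $H^m(\Gamma,\Gamma';V)=0$ for every $m>n$ and every bounded $\Gamma$-module $V$. -/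

import Mathlib

universe u v w

namespace RelHyp

/-! ### Cusped graphs and relatively hyperbolic pairs -/

/-- The combinatorial horoball on a graph `G`: the vertex set is `G⁰ × ℕ` (the second coordinate is
the height), height `0` carries a copy of `G`, there is a vertical edge between `(g, n)` and
`(g, n + 1)`, and `(g, n)`, `(h, n)` with `n ≥ 1`, `g ≠ h` are joined iff `d_G(g, h) ≤ 2 ^ n`.
The distance is the extended one, so points in different components of `G` are never joined, and
the horoball on a disjoint union of graphs is the disjoint union of the horoballs. -/
def horoball {A : Type*} (G : SimpleGraph A) : SimpleGraph (A × ℕ) where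
  Adj p q :=
    (p.2 = 0 ∧ q.2 = 0 ∧ G.Adj p.1 q.1) ∨
    (p.1 = q.1 ∧ (q.2 = p.2 + 1 ∨ p.2 = q.2 + 1)) ∨
    (p.2 = q.2 ∧ 1 ≤ p.2 ∧ p.1 ≠ q.1 ∧ G.edist p.1 q.1 ≤ 2 ^ p.2)
  symm := ⟨by
    rintro ⟨g, m⟩ ⟨h, n⟩ H
    rcases H with ⟨h1, h2, h3⟩ | ⟨h1, h2⟩ | ⟨h1, h2, h3, h4⟩
    · exact Or.inl ⟨h2, h1, h3.symm⟩
    · exact Or.inr (Or.inl ⟨h1.symm, h2.symm⟩)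
    · refine Or.inr (Or.inr ⟨h1.symm, ?_, h3.symm, ?_⟩)
      · simp only at h1 h2 ⊢; omega
      · simp only at h1 h4 ⊢; rw [SimpleGraph.edist_comm, ← h1]; exact h4⟩
  loopless := ⟨by
    rintro ⟨g, m⟩ H
    rcases H with ⟨_, _, h3⟩ | ⟨_, h2⟩ | ⟨_, _, h3, _⟩
    · exact h3.ne rfl
    · simp at h2
    · exact h3 rfl⟩

/-- The vertices of the cusped graph: `base g` is the vertex `(g, i, 0)` (the same for all `i`) and
`deep g i n` is the vertex `(g, i, n + 1)`. -/
inductive CuspedVertex (Γ : Type u) (I : Type v) : Type (max u v)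
  | base (g : Γ) : CuspedVertex Γ I
  | deep (g : Γ) (i : I) (n : ℕ) : CuspedVertex Γ I

/-- The vertex `(g, i, n)` of the cusped graph, for `p = (g, n)`. -/
def cuspedVertex {Γ : Type u} {I : Type v} (i : I) (p : Γ × ℕ) : CuspedVertex Γ I :=
  match p.2 with
  | 0 => CuspedVertex.base p.1
  | n + 1 => CuspedVertex.deep p.1 i n

/-- The cusped graph of `(Γ, {P i})` with respect to `S`: the simplicial Cayley graph of `Γ`
(`g` and `g * s` are joined for `s ∈ S`), to which one glues, for each `i` and each coset
`g P_i`, the horoball on that coset. For fixed `i`, the Cayley graph on `Γ` with respect to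
`S ∩ P_i` is the disjoint union of the left translates `g • Cay(P_i, S ∩ P_i)`, whose vertex sets
are the cosets `g P_i`; hence the horoball on it is the disjoint union of the horoballs on these. -/
def cuspedGraph {Γ : Type u} {I : Type v} [Group Γ] (P : I → Subgroup Γ) (S : Set Γ) :
    SimpleGraph (CuspedVertex Γ I) :=
  (SimpleGraph.mulCayley S).map CuspedVertex.base ⊔
    ⨆ i, (horoball (SimpleGraph.mulCayley (S ∩ (P i : Set Γ)))).map (cuspedVertex i)

/-- The Gromov product `(x | y)_w` of vertices of a graph, for the graph metric. -/
noncomputable def gromovProduct {A : Type*} (G : SimpleGraph A) (w x y : A) : ℝ :=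
  ((G.dist x w : ℝ) + (G.dist y w : ℝ) - (G.dist x y : ℝ)) / 2

/-- A graph is Gromov hyperbolic if it is connected and, for some `δ`, its vertices with the graph
metric form a `δ`-hyperbolic metric space in the sense of Gromov. -/
def IsGromovHyperbolic {A : Type*} (G : SimpleGraph A) : Prop :=
  G.Connected ∧ ∃ δ : ℝ, ∀ w x y z : A,
    min (gromovProduct G w x y) (gromovProduct G w y z) - δ ≤ gromovProduct G w x z

/-- `S` is a compatible generating set: finite, symmetric, without `1`, generating `Γ`, and such
that `S ∩ P i` generates `P i` for each `i`. -/
structure IsCompatible {Γ : Type u} {I : Type v} [Group Γ] (P : I → Subgroup Γ) (S : Set Γ) :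
    Prop where
  finite : S.Finite
  one_notMem : (1 : Γ) ∉ S
  inv_mem : ∀ s ∈ S, s⁻¹ ∈ S
  closure_eq_top : Subgroup.closure S = ⊤
  closure_inter_eq : ∀ i, Subgroup.closure (S ∩ (P i : Set Γ)) = P i

/-- The pair `(Γ, {P i})` is relatively hyperbolic if, for a compatible finite generating set, its
cusped graph is Gromov hyperbolic. In particular `Γ` and all `P i` are finitely generated. -/
def IsRelativelyHyperbolic {Γ : Type u} {I : Type v} [Group Γ] (P : I → Subgroup Γ) : Prop :=
  ∃ S : Set Γ, IsCompatible P S ∧ IsGromovHyperbolic (cuspedGraph P S)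

/-! ### The standard complex of a pair -/

/-- `C_k(X)`: the real vector space with basis `X ^ (k + 1)`. -/
abbrev Chain (X : Type*) (k : ℕ) : Type _ := (Fin (k + 1) → X) →₀ ℝ

/-- The boundary `∂ (x₀, …, x_{k+1}) = ∑ j, (-1) ^ j (x₀, …, x̂_j, …, x_{k+1})`. -/
noncomputable def boundary (X : Type*) (k : ℕ) : Chain X (k + 1) →ₗ[ℝ] Chain X k :=
  Finsupp.linearCombination ℝ fun x : Fin (k + 2) → X =>
    ∑ j : Fin (k + 2), (-1 : ℝ) ^ (j : ℕ) • Finsupp.single (fun a => x (j.succAbove a)) (1 : ℝ)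

lemma boundary_single {X : Type*} {k : ℕ} (x : Fin (k + 2) → X) :
    boundary X k (Finsupp.single x 1) = ∑ j : Fin (k + 2),
      (-1 : ℝ) ^ (j : ℕ) • Finsupp.single (fun a => x (j.succAbove a)) (1 : ℝ) := by
  simp [boundary]

lemma boundary_comp_boundary (X : Type*) (k : ℕ) :
    boundary X k ∘ₗ boundary X (k + 1) = 0 := by
  refine Finsupp.lhom_ext' fun x => LinearMap.ext_ring ?_
  simp only [LinearMap.comp_apply, Finsupp.lsingle_apply, boundary_single, map_sum, map_smul,
    Finset.smul_sum, smul_smul, LinearMap.zero_apply, ← Finset.sum_product']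
  let T : Finset (Fin (k + 3) × Fin (k + 2)) := {p | (p.1 : ℕ) ≤ (p.2 : ℕ)}
  rw [Finset.univ_product_univ, ← Finset.sum_add_sum_compl T, ← eq_neg_iff_add_eq_zero,
    ← Finset.sum_neg_distrib]
  refine Finset.sum_bij
    (fun p hp => (p.2.succ, p.1.castLT (lt_of_le_of_lt (Finset.mem_filter.mp hp).2 p.2.2)))
    ?_ ?_ ?_ ?_
  · rintro ⟨i, j⟩ hp
    simp only [T, Finset.mem_filter_univ, Finset.mem_compl, Fin.val_succ, Fin.val_castLT] at hp ⊢
    omega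
  · rintro ⟨i, j⟩ hp ⟨i', j'⟩ hp' h
    simp only [Prod.mk.injEq, Fin.ext_iff, Fin.val_succ, Fin.val_castLT] at h ⊢
    omega
  · rintro ⟨i, j⟩ hp
    simp only [T, Finset.mem_filter_univ, Finset.mem_compl, not_le] at hp
    refine ⟨(j.castSucc, ⟨(i : ℕ) - 1, by omega⟩), ?_, ?_⟩
    · simp only [T, Finset.mem_filter_univ, Fin.val_castSucc]
      omega
    · simp only [Prod.mk.injEq, Fin.ext_iff, Fin.val_succ, Fin.val_castLT, Fin.val_castSucc,
        and_true]
      omega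
  · rintro ⟨i, j⟩ hp
    simp only [T, Finset.mem_filter_univ] at hp
    rw [← neg_smul]
    congr 1
    · simp only [Fin.val_succ, Fin.val_castLT]
      ring
    · congr 1
      funext a
      congr 1
      simp only [Fin.ext_iff, Fin.succAbove, Fin.lt_def]
      split_ifs <;> simp_all <;> omega

section Pair

variable {Γ : Type u} {I : Type v} [Group Γ]

/-- The action of `Γ` on tuples of elements of `Γ × I` by left translation of the `Γ`-factors. -/
def translate {k : ℕ} (γ : Γ) (x : Fin (k + 1) → Γ × I) : Fin (k + 1) → Γ × I :=
  fun a => (γ * (x a).1, (x a).2)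

lemma translate_one {k : ℕ} (x : Fin (k + 1) → Γ × I) : translate 1 x = x := by
  funext a
  simp [translate]

lemma translate_mul {k : ℕ} (γ₁ γ₂ : Γ) (x : Fin (k + 1) → Γ × I) :
    translate (γ₁ * γ₂) x = translate γ₁ (translate γ₂ x) := by
  funext a
  simp [translate, mul_assoc]

variable (Γ I) in
/-- `St_k = C_k(Γ × I)` as a `Γ`-module. -/
noncomputable def stRep (k : ℕ) : Representation ℝ Γ (Chain (Γ × I) k) where
  toFun γ := Finsupp.lmapDomain ℝ ℝ (translate γ)
  map_one' := by
    ext x : 2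
    simp [translate_one]
  map_mul' γ₁ γ₂ := by
    ext x : 2
    simp [translate_mul]

lemma stRep_single {k : ℕ} (γ : Γ) (x : Fin (k + 1) → Γ × I) (r : ℝ) :
    stRep Γ I k γ (Finsupp.single x r) = Finsupp.single (translate γ x) r := by
  simp [stRep]

/-- The tuples that span `St'_k`: all entries lie in one copy `Γ × {i}` of `Γ`, and in one left
coset of `P i` there. -/
def IsPeripheral (P : I → Subgroup Γ) {k : ℕ} (x : Fin (k + 1) → Γ × I) : Prop :=
  ∃ i : I, (∀ j, (x j).2 = i) ∧ ∀ j, (x 0).1⁻¹ * (x j).1 ∈ P i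

/-- The subspace `St'_k` of `St_k`. -/
noncomputable def stPrime (P : I → Subgroup Γ) (k : ℕ) : Submodule ℝ (Chain (Γ × I) k) :=
  Submodule.span ℝ {c | ∃ x : Fin (k + 1) → Γ × I, IsPeripheral P x ∧ c = Finsupp.single x 1}

lemma IsPeripheral.comp {P : I → Subgroup Γ} {k l : ℕ} {x : Fin (k + 1) → Γ × I}
    (hx : IsPeripheral P x) (f : Fin (l + 1) → Fin (k + 1)) :
    IsPeripheral P (fun a => x (f a)) := by
  obtain ⟨i, h1, h2⟩ := hx
  refine ⟨i, fun j => h1 _, fun j => ?_⟩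
  have := (P i).mul_mem ((P i).inv_mem (h2 (f 0))) (h2 (f j))
  simpa [mul_assoc] using this

lemma IsPeripheral.translate {P : I → Subgroup Γ} {k : ℕ} {x : Fin (k + 1) → Γ × I}
    (hx : IsPeripheral P x) (γ : Γ) : IsPeripheral P (translate γ x) := by
  obtain ⟨i, h1, h2⟩ := hx
  refine ⟨i, h1, fun j => ?_⟩
  simpa [RelHyp.translate, mul_assoc] using h2 j

lemma stPrime_le_comap_stRep (P : I → Subgroup Γ) (k : ℕ) (γ : Γ) :
    stPrime P k ≤ (stPrime P k).comap (stRep Γ I k γ) := by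
  refine Submodule.span_le.2 ?_
  rintro _ ⟨x, hx, rfl⟩
  refine Submodule.subset_span ⟨_, hx.translate γ, ?_⟩
  exact stRep_single γ x 1

lemma stPrime_le_comap_boundary (P : I → Subgroup Γ) (k : ℕ) :
    stPrime P (k + 1) ≤ (stPrime P k).comap (boundary (Γ × I) k) := by
  refine Submodule.span_le.2 ?_
  rintro _ ⟨x, hx, rfl⟩
  simp only [Submodule.comap_coe, Set.mem_preimage, SetLike.mem_coe, boundary_single]
  exact Submodule.sum_mem _ fun j _ => Submodule.smul_mem _ _
    (Submodule.subset_span ⟨_, hx.comp _, rfl⟩)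

/-- `St^rel_k = St_k / St'_k`. -/
abbrev StRel (P : I → Subgroup Γ) (k : ℕ) : Type _ := Chain (Γ × I) k ⧸ stPrime P k

/-- `St^rel_k` as a `Γ`-module. -/
noncomputable def stRelRep (P : I → Subgroup Γ) (k : ℕ) : Representation ℝ Γ (StRel P k) :=
  (stRep Γ I k).quotient (stPrime P k) (stPrime_le_comap_stRep P k)

lemma boundary_stRep (k : ℕ) (γ : Γ) :
    boundary (Γ × I) k ∘ₗ stRep Γ I (k + 1) γ = stRep Γ I k γ ∘ₗ boundary (Γ × I) k := by
  refine Finsupp.lhom_ext' fun x => LinearMap.ext_ring ?_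
  simp only [LinearMap.comp_apply, Finsupp.lsingle_apply, stRep_single, boundary_single, map_sum,
    map_smul]
  rfl

/-- The boundary `St^rel_{k+1} → St^rel_k`, a map of `Γ`-modules. -/
noncomputable def boundaryRel (P : I → Subgroup Γ) (k : ℕ) :
    (stRelRep P (k + 1)).IntertwiningMap (stRelRep P k) where
  toLinearMap := Submodule.mapQ _ _ (boundary (Γ × I) k) (stPrime_le_comap_boundary P k)
  isIntertwining' γ := by
    refine Submodule.linearMap_qext _ (LinearMap.ext fun c => ?_)
    have := LinearMap.congr_fun (boundary_stRep (I := I) k γ) c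
    simp only [LinearMap.comp_apply] at this
    simp [stRelRep, this]

/-! ### Relative cohomology -/

variable {V : Type w}

/-- The cochains `Hom^Γ(St^rel_k, V)`: the `Γ`-equivariant linear maps `St^rel_k → V`. -/
abbrev RelCochain [AddCommGroup V] [Module ℝ V] (P : I → Subgroup Γ) (ρ : Representation ℝ Γ V)
    (k : ℕ) : Type _ :=
  (stRelRep P k).IntertwiningMap ρ

/-- The coboundary `f ↦ f ∘ ∂`. -/
noncomputable def coboundary [AddCommGroup V] [Module ℝ V] (P : I → Subgroup Γ)
    (ρ : Representation ℝ Γ V) (k : ℕ) : RelCochain P ρ k →ₗ[ℝ] RelCochain P ρ (k + 1) where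
  toFun f := f.comp (boundaryRel P k)
  map_add' _ _ := rfl
  map_smul' _ _ := rfl

lemma coboundary_comp_coboundary [AddCommGroup V] [Module ℝ V] (P : I → Subgroup Γ)
    (ρ : Representation ℝ Γ V) (k : ℕ) : coboundary P ρ (k + 1) ∘ₗ coboundary P ρ k = 0 := by
  refine LinearMap.ext fun f => ?_
  refine Representation.IntertwiningMap.ext (Submodule.linearMap_qext _ (LinearMap.ext fun c => ?_))
  have h := LinearMap.congr_fun (boundary_comp_boundary (Γ × I) k) c
  simp only [LinearMap.comp_apply, LinearMap.zero_apply] at h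
  change f (Submodule.Quotient.mk (boundary (Γ × I) k (boundary (Γ × I) (k + 1) c))) = 0
  rw [h, Submodule.Quotient.mk_zero, map_zero]

/-- The coboundaries of degree `k`: the image of the coboundary map from degree `k - 1`. -/
noncomputable def relCoboundaries [AddCommGroup V] [Module ℝ V] (P : I → Subgroup Γ)
    (ρ : Representation ℝ Γ V) : (k : ℕ) → Submodule ℝ (RelCochain P ρ k)
  | 0 => ⊥
  | k + 1 => LinearMap.range (coboundary P ρ k)

/-- The relative cohomology `H^k(Γ, Γ'; V)` of the pair, i.e. cocycles modulo coboundaries in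
`Hom^Γ(St^rel_*, V)`. -/
abbrev RelCohomology [AddCommGroup V] [Module ℝ V] (P : I → Subgroup Γ)
    (ρ : Representation ℝ Γ V) (k : ℕ) : Type _ :=
  LinearMap.ker (coboundary P ρ k) ⧸ (relCoboundaries P ρ k).submoduleOf
    (LinearMap.ker (coboundary P ρ k))

/-- A linear action of `Γ` on a normed space makes it a bounded `Γ`-module if the operators are
equibounded. -/
def IsBoundedModule [NormedAddCommGroup V] [NormedSpace ℝ V] (ρ : Representation ℝ Γ V) : Prop :=
  ∃ L : ℝ, 0 < L ∧ ∀ (γ : Γ) (x : V), ‖ρ γ x‖ ≤ L * ‖x‖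

end Pair

end RelHyp

/-! Let `s` be the constant of the four-point inequality of the cusped graph, put N = 2(s + 1), and
consider the Rips complex of tuples of vertices with pairwise distances at most N. It serves as a
model of the pair that is finite-dimensional away from the horoballs. Three facts about it are
needed. (1) The Rips complex is acyclic, and so is its part over heights above N in any single
horoball (`exists_boundary_of_four_point`, `exists_boundary_deepCoset`). Both follow by dismantling:
hyperbolicity lets an extremal vertex be replaced by one closer to a base point, or higher up,
without losing neighbours. (2) Simplices with distinct vertices, one of which has height at most N,
have boundedly many vertices, because such a simplex can be translated into a fixed finite set
(`exists_card_bound`). (3) A simplex with all heights above N lies in one horoball, so it projects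
to a peripheral tuple (`eq_deep_of_dist_le`).

By (1), acyclic carriers give an equivariant chain map φ from the standard complex to the Rips
complex that sends peripheral tuples deep into their horoballs. Antisymmetrize φ, which kills tuples
with repeated vertices, and project back to Γ × I. The resulting endomorphism θ is equivariantly
homotopic to the identity by a homotopy that preserves St'. By (2) and (3), θ has values in St' in
high degrees. Hence the identity of St^rel is null-homotopic there, and composing a cocycle with the
homotopy yields a primitive up to sign. -/

namespace RelHyp

/-! ### Augmented tuple chains -/

/-- The real vector space with basis `X ^ n`. For `n = 0` this is the augmentation module. -/
abbrev TupleChain (X : Type*) (n : ℕ) : Type _ := (Fin n → X) →₀ ℝ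

/-- The boundary of tuple chains, including the augmentation in the lowest degree. -/
noncomputable def tupleBoundary (X : Type*) (n : ℕ) : TupleChain X (n + 1) →ₗ[ℝ] TupleChain X n :=
  Finsupp.linearCombination ℝ fun x : Fin (n + 1) → X =>
    ∑ j : Fin (n + 1), (-1 : ℝ) ^ (j : ℕ) • Finsupp.single (fun a => x (j.succAbove a)) (1 : ℝ)

lemma tupleBoundary_succ (X : Type*) (k : ℕ) : tupleBoundary X (k + 1) = boundary X k := rfl

lemma tupleBoundary_single {X : Type*} {n : ℕ} (x : Fin (n + 1) → X) :
    tupleBoundary X n (Finsupp.single x 1) = ∑ j : Fin (n + 1),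
      (-1 : ℝ) ^ (j : ℕ) • Finsupp.single (fun a => x (j.succAbove a)) (1 : ℝ) := by
  simp [tupleBoundary]

/-- Linear maps on a space of tuple chains agree if they agree on tuples. -/
lemma tupleChain_hom_ext {B M : Type*} [AddCommGroup M] [Module ℝ M] {f g : (B →₀ ℝ) →ₗ[ℝ] M}
    (h : ∀ x, f (Finsupp.single x 1) = g (Finsupp.single x 1)) : f = g :=
  Finsupp.lhom_ext' fun x => LinearMap.ext_ring (h x)

lemma tupleBoundary_comp_tupleBoundary (X : Type*) (n : ℕ) :
    tupleBoundary X n ∘ₗ tupleBoundary X (n + 1) = 0 := by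
  cases n with
  | zero =>
    refine tupleChain_hom_ext fun x => ?_
    simp [tupleBoundary_single, Fin.sum_univ_two, Subsingleton.elim _ (default : Fin 0 → X)]
  | succ n => exact boundary_comp_boundary X n

lemma tupleBoundary_tupleBoundary {X : Type*} {n : ℕ} (c : TupleChain X (n + 2)) :
    tupleBoundary X n (tupleBoundary X (n + 1) c) = 0 :=
  LinearMap.congr_fun (tupleBoundary_comp_tupleBoundary X n) c

/-- The map of tuple chains induced by a map of vertices. -/
noncomputable def tupleMap {X Y : Type*} (f : X → Y) (n : ℕ) : TupleChain X n →ₗ[ℝ] TupleChain Y n :=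
  Finsupp.lmapDomain ℝ ℝ (fun x => f ∘ x)

lemma tupleMap_single {X Y : Type*} (f : X → Y) {n : ℕ} (x : Fin n → X) (r : ℝ) :
    tupleMap f n (Finsupp.single x r) = Finsupp.single (f ∘ x) r := by
  simp [tupleMap]

lemma tupleBoundary_tupleMap {X Y : Type*} (f : X → Y) {n : ℕ} (c : TupleChain X (n + 1)) :
    tupleBoundary Y n (tupleMap f (n + 1) c) = tupleMap f n (tupleBoundary X n c) := by
  refine LinearMap.congr_fun (f := tupleBoundary Y n ∘ₗ tupleMap f (n + 1))
    (g := tupleMap f n ∘ₗ tupleBoundary X n) (tupleChain_hom_ext fun x => ?_) c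
  simp only [LinearMap.comp_apply, tupleMap_single, tupleBoundary_single, map_sum, map_smul]
  rfl

lemma tupleMap_tupleMap {X Y Z : Type*} (f : X → Y) (g : Y → Z) {n : ℕ} (c : TupleChain X n) :
    tupleMap g n (tupleMap f n c) = tupleMap (g ∘ f) n c := by
  refine LinearMap.congr_fun (f := tupleMap g n ∘ₗ tupleMap f n)
    (g := tupleMap (g ∘ f) n) (tupleChain_hom_ext fun x => ?_) c
  simp only [LinearMap.comp_apply, tupleMap_single, Function.comp_assoc]

/-- The cone of a tuple chain with apex `p`. -/
noncomputable def tupleCone {X : Type*} (p : X) (n : ℕ) :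
    TupleChain X n →ₗ[ℝ] TupleChain X (n + 1) :=
  Finsupp.lmapDomain ℝ ℝ (fun x => (Fin.cons p x : Fin (n + 1) → X))

lemma tupleCone_single {X : Type*} (p : X) {n : ℕ} (x : Fin n → X) (r : ℝ) :
    tupleCone p n (Finsupp.single x r) = Finsupp.single (Fin.cons p x : Fin (n + 1) → X) r := by
  simp [tupleCone]

/-- Deleting the apex gives back the tuple, and every other face is a cone with its sign reversed.
In particular a cycle bounds its cone. -/
lemma tupleBoundary_tupleCone {X : Type*} (p : X) {n : ℕ} (c : TupleChain X (n + 1)) :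
    tupleBoundary X (n + 1) (tupleCone p (n + 1) c) = c - tupleCone p n (tupleBoundary X n c) := by
  refine LinearMap.congr_fun (f := tupleBoundary X (n + 1) ∘ₗ tupleCone p (n + 1))
    (g := LinearMap.id - tupleCone p n ∘ₗ tupleBoundary X n) (tupleChain_hom_ext fun x => ?_) c
  simp only [LinearMap.comp_apply, tupleCone_single, tupleBoundary_single, map_sum, map_smul,
    LinearMap.sub_apply, LinearMap.id_apply]
  rw [Fin.sum_univ_succ, sub_eq_add_neg, ← Finset.sum_neg_distrib]
  congr 1
  · simp
  · refine Finset.sum_congr rfl fun j _ => ?_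
    rw [← neg_smul]
    congr 1
    · simp [pow_succ]
    · congr 1
      funext a
      refine Fin.cases ?_ (fun a => ?_) a <;> simp

/-- A linear map that maps the tuples in `s` into `M` maps all chains supported in `s` into `M`. -/
lemma mem_of_mem_supported {B M : Type*} [AddCommGroup M] [Module ℝ M] {F : (B →₀ ℝ) →ₗ[ℝ] M}
    {s : Set B} {N : Submodule ℝ M} (h : ∀ x ∈ s, F (Finsupp.single x 1) ∈ N) {c : B →₀ ℝ}
    (hc : c ∈ Finsupp.supported ℝ ℝ s) : F c ∈ N := by
  rw [Finsupp.supported_eq_span_single] at hc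
  have : Submodule.span ℝ ((fun i => Finsupp.single i (1 : ℝ)) '' s) ≤ N.comap F := by
    rw [Submodule.span_le]
    rintro _ ⟨x, hx, rfl⟩
    exact h x hx
  exact this hc

lemma tupleBoundary_single_mem {X M : Type*} [AddCommGroup M] [Module ℝ M] {n : ℕ}
    {F : TupleChain X n →ₗ[ℝ] M} {N : Submodule ℝ M} {x : Fin (n + 1) → X}
    (h : ∀ j : Fin (n + 1), F (Finsupp.single (fun a => x (j.succAbove a)) 1) ∈ N) :
    F (tupleBoundary X n (Finsupp.single x 1)) ∈ N := by
  rw [tupleBoundary_single, map_sum]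
  refine Submodule.sum_mem _ fun j _ => ?_
  rw [map_smul]
  exact Submodule.smul_mem _ _ (h j)

/-! ### Equivariant lifting -/

section Equivariant

variable {Γ : Type*} [Group Γ]

/-- The permutation representation on tuple chains. -/
noncomputable def tupleRep (Γ X : Type*) [Group Γ] [MulAction Γ X] (n : ℕ) :
    Representation ℝ Γ (TupleChain X n) where
  toFun γ := tupleMap (fun x => γ • x) n
  map_one' := by
    refine tupleChain_hom_ext fun x => ?_
    simp [tupleMap_single, Function.comp_def]
  map_mul' γ₁ γ₂ := by
    refine tupleChain_hom_ext fun x => ?_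
    simp [tupleMap_single, Function.comp_def, mul_smul]

lemma tupleRep_single {X : Type*} [MulAction Γ X] {n : ℕ} (γ : Γ) (x : Fin n → X) (r : ℝ) :
    tupleRep Γ X n γ (Finsupp.single x r) = Finsupp.single (γ • x) r :=
  tupleMap_single _ _ _

lemma tupleBoundary_tupleRep {X : Type*} [MulAction Γ X] {n : ℕ} (γ : Γ)
    (c : TupleChain X (n + 1)) :
    tupleBoundary X n (tupleRep Γ X (n + 1) γ c) = tupleRep Γ X n γ (tupleBoundary X n c) :=
  tupleBoundary_tupleMap _ c

/-- Equivariance of a linear map between tuple chains. -/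
def IsTupleEquivariant (Γ : Type*) [Group Γ] {X Y : Type*} [MulAction Γ X] [MulAction Γ Y] {m n : ℕ}
    (f : TupleChain X m →ₗ[ℝ] TupleChain Y n) : Prop :=
  ∀ γ c, f (tupleRep Γ X m γ c) = tupleRep Γ Y n γ (f c)

lemma isTupleEquivariant_of_single {X Y : Type*} [MulAction Γ X] [MulAction Γ Y] {m n : ℕ}
    {f : TupleChain X m →ₗ[ℝ] TupleChain Y n}
    (h : ∀ (γ : Γ) x, f (Finsupp.single (γ • x) 1) = tupleRep Γ Y n γ (f (Finsupp.single x 1))) :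
    IsTupleEquivariant Γ f := by
  intro γ c
  refine LinearMap.congr_fun (f := f ∘ₗ tupleRep Γ X m γ) (g := tupleRep Γ Y n γ ∘ₗ f)
    (tupleChain_hom_ext fun x => ?_) c
  simp [tupleRep_single, h]

lemma isTupleEquivariant_tupleMap {X Y : Type*} [MulAction Γ X] [MulAction Γ Y] {f : X → Y}
    (hf : ∀ (γ : Γ) x, f (γ • x) = γ • f x) (n : ℕ) : IsTupleEquivariant Γ (tupleMap f n) := by
  refine isTupleEquivariant_of_single fun γ x => ?_
  rw [tupleMap_single, tupleMap_single, tupleRep_single]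
  congr 1
  funext a
  exact hf γ (x a)

/-- If `Γ` acts freely on the tuples, then lifts that exist tuple by tuple can be chosen
equivariantly. -/
lemma exists_equivariant_lift {X Y : Type*} [MulAction Γ X] [MulAction Γ Y]
    (hfree : ∀ (γ : Γ) (x : X), γ • x = x → γ = 1) {m n : ℕ}
    (Φ : (Fin (m + 1) → X) → Submodule ℝ (TupleChain Y (n + 1)))
    (hΦ : ∀ (γ : Γ) x c, c ∈ Φ x → tupleRep Γ Y (n + 1) γ c ∈ Φ (γ • x))
    {f : TupleChain X (m + 1) →ₗ[ℝ] TupleChain Y n} (hf : IsTupleEquivariant Γ f)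
    (hex : ∀ x, ∃ c ∈ Φ x, tupleBoundary Y n c = f (Finsupp.single x 1)) :
    ∃ F : TupleChain X (m + 1) →ₗ[ℝ] TupleChain Y (n + 1), IsTupleEquivariant Γ F ∧
      (∀ x, F (Finsupp.single x 1) ∈ Φ x) ∧ tupleBoundary Y n ∘ₗ F = f := by
  choose c hcΦ hc using hex
  -- A representative of each orbit. Lifts are chosen only for representatives and then transported
  -- along the unique `g x` with `g x • r x = x`.
  let r : (Fin (m + 1) → X) → (Fin (m + 1) → X) := fun x =>
    (Quotient.mk (MulAction.orbitRel Γ (Fin (m + 1) → X)) x).out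
  have hr : ∀ x, ∃ γ : Γ, γ • r x = x := fun x => by
    have : (MulAction.orbitRel Γ (Fin (m + 1) → X)).r (r x) x := Quotient.mk_out x
    have h2 := (MulAction.orbitRel Γ (Fin (m + 1) → X)).symm this
    exact h2
  have hr2 : ∀ (γ : Γ) x, r (γ • x) = r x := fun γ x => by
    have : Quotient.mk (MulAction.orbitRel Γ (Fin (m + 1) → X)) (γ • x) =
        Quotient.mk (MulAction.orbitRel Γ (Fin (m + 1) → X)) x := Quotient.sound ⟨γ, rfl⟩
    simp only [r, this]
  choose g hg using hr
  have hg2 : ∀ (γ : Γ) x, g (γ • x) = γ * g x := fun γ x => by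
    have h1 := hg (γ • x)
    rw [hr2] at h1
    have h2 : γ • x = (γ * g x) • r x := by rw [mul_smul, hg]
    rw [h2] at h1
    have h3 : ((γ * g x)⁻¹ * g (((γ * g x) • r x))) • r x = r x := by
      rw [mul_smul, inv_smul_eq_iff]
      exact h1
    -- An element that fixes a tuple fixes its entry 0, which exists since the tuples have length `m
    -- + 1`. Hence `g` is equivariant.
    have h4 := hfree _ (r x 0) (congrFun h3 0)
    rw [← h2] at h4
    exact (inv_mul_eq_one.1 h4).symm
  let F : TupleChain X (m + 1) →ₗ[ℝ] TupleChain Y (n + 1) :=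
    Finsupp.linearCombination ℝ fun x => tupleRep Γ Y (n + 1) (g x) (c (r x))
  have hF : ∀ x, F (Finsupp.single x 1) = tupleRep Γ Y (n + 1) (g x) (c (r x)) := fun x => by
    simp [F]
  refine ⟨F, isTupleEquivariant_of_single fun γ x => ?_, fun x => ?_, tupleChain_hom_ext fun x => ?_⟩
  · rw [hF, hF, hr2, hg2, map_mul]
    rfl
  · rw [hF]
    have := hΦ (g x) _ _ (hcΦ (r x))
    rwa [hg] at this
  · rw [LinearMap.comp_apply, hF, tupleBoundary_tupleRep, hc, ← hf, tupleRep_single, hg]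

/-- An acyclic carrier: it assigns to every tuple in `X` a submodule of the tuple chains of `Y`,
compatibly with faces and with the action of `Γ`, with the reduced homology zero. -/
structure IsAcyclicCarrier (Γ : Type*) [Group Γ] {X Y : Type*} [MulAction Γ X] [MulAction Γ Y]
    (K : ∀ m, (Fin m → X) → ∀ n, Submodule ℝ (TupleChain Y n)) : Prop where
  mono : ∀ m (x : Fin (m + 1) → X) (j : Fin (m + 1)) n, K m (fun a => x (j.succAbove a)) n ≤ K _ x n
  equivariant : ∀ (γ : Γ) m (x : Fin m → X) n c, c ∈ K m x n → tupleRep Γ Y n γ c ∈ K m (γ • x) n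
  exists_boundary : ∀ m (x : Fin (m + 1) → X) n (c : TupleChain Y (n + 1)), c ∈ K _ x (n + 1) →
    tupleBoundary Y n c = 0 → ∃ b ∈ K _ x (n + 2), tupleBoundary Y (n + 1) b = c

lemma exists_dependent_seq {S : ℕ → Type*} (s₀ : S 0) {r : ∀ n, S n → S (n + 1) → Prop}
    (h : ∀ n s, ∃ s', r n s s') : ∃ s : ∀ n, S n, s 0 = s₀ ∧ ∀ n, r n (s n) (s (n + 1)) := by
  choose f hf using h
  exact ⟨fun n => Nat.rec s₀ f n, rfl, fun n => hf n _⟩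

variable {X Y : Type*} [MulAction Γ X] [MulAction Γ Y]
  {K : ∀ m, (Fin m → X) → ∀ n, Submodule ℝ (TupleChain Y n)}

/-- The acyclic carrier theorem: existence of equivariant chain maps. -/
theorem IsAcyclicCarrier.exists_chainMap (hK : IsAcyclicCarrier Γ K)
    (hfree : ∀ (γ : Γ) (x : X), γ • x = x → γ = 1) {f : X → Y}
    (hf : ∀ (γ : Γ) x, f (γ • x) = γ • f x)
    (hfK : ∀ x : Fin 1 → X, Finsupp.single (f ∘ x) 1 ∈ K 1 x 1) :
    ∃ φ : ∀ n, TupleChain X n →ₗ[ℝ] TupleChain Y n, φ 0 = tupleMap f 0 ∧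
      (∀ n c, tupleBoundary Y n (φ (n + 1) c) = φ n (tupleBoundary X n c)) ∧
      (∀ n, IsTupleEquivariant Γ (φ n)) ∧
      ∀ n (x : Fin (n + 1) → X), φ (n + 1) (Finsupp.single x 1) ∈ K _ x (n + 1) := by
  -- The last clause says that `φ` maps boundaries to cycles. This is all that the next lift needs,
  -- so the recursion has to remember only one degree.
  let S : ℕ → Type _ := fun n => {φ : TupleChain X (n + 1) →ₗ[ℝ] TupleChain Y (n + 1) //
    IsTupleEquivariant Γ φ ∧ (∀ x, φ (Finsupp.single x 1) ∈ K _ x (n + 1)) ∧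
    ∀ c, tupleBoundary Y n (φ (tupleBoundary X (n + 1) c)) = 0}
  have step : ∀ n (s : S n), ∃ s' : S (n + 1),
      ∀ c, tupleBoundary Y (n + 1) (s'.1 c) = s.1 (tupleBoundary X (n + 1) c) := by
    rintro n ⟨φ, h1, h2, h3⟩
    obtain ⟨F, hF1, hF2, hF3⟩ := exists_equivariant_lift (Γ := Γ) hfree
      (Φ := fun x => K (n + 1 + 1) x (n + 2)) (fun γ x c hc => hK.equivariant γ _ x _ c hc)
      (f := φ ∘ₗ tupleBoundary X (n + 1))
      (fun γ c => by
        rw [LinearMap.comp_apply, LinearMap.comp_apply, tupleBoundary_tupleRep, h1])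
      (fun x => hK.exists_boundary _ x n _
        (tupleBoundary_single_mem fun j => hK.mono _ x j _ (h2 _)) (h3 _))
    have hF4 := fun c => LinearMap.congr_fun hF3 c
    simp only [LinearMap.comp_apply] at hF4
    refine ⟨⟨F, hF1, hF2, fun c => ?_⟩, hF4⟩
    rw [hF4, tupleBoundary_tupleBoundary, map_zero]
  obtain ⟨s, hs0, hs⟩ := exists_dependent_seq (S := S)
    ⟨tupleMap f 1, isTupleEquivariant_tupleMap hf 1, fun x => by
      rw [tupleMap_single]
      exact hfK x, fun c => by
      rw [tupleBoundary_tupleMap, tupleBoundary_tupleBoundary, map_zero]⟩ step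
  refine ⟨fun n => match n with
    | 0 => tupleMap f 0
    | n + 1 => (s n).1, rfl, fun n => ?_, fun n => ?_, fun n x => (s n).2.2.1 x⟩
  · cases n with
    | zero =>
      intro c
      simp only [hs0]
      exact tupleBoundary_tupleMap f c
    | succ n => exact hs n
  · cases n with
    | zero => exact isTupleEquivariant_tupleMap hf 0
    | succ n => exact (s n).2.1

/-- The acyclic carrier theorem: uniqueness of equivariant chain maps up to homotopy. -/
theorem IsAcyclicCarrier.exists_homotopy (hK : IsAcyclicCarrier Γ K)
    (hfree : ∀ (γ : Γ) (x : X), γ • x = x → γ = 1)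
    {t : ∀ n, TupleChain X n →ₗ[ℝ] TupleChain Y n} (ht0 : t 0 = 0)
    (htb : ∀ n c, tupleBoundary Y n (t (n + 1) c) = t n (tupleBoundary X n c))
    (hte : ∀ n, IsTupleEquivariant Γ (t n))
    (htK : ∀ n (x : Fin (n + 1) → X), t (n + 1) (Finsupp.single x 1) ∈ K _ x (n + 1)) :
    ∃ h : ∀ n, TupleChain X n →ₗ[ℝ] TupleChain Y (n + 1),
      (∀ n, IsTupleEquivariant Γ (h n)) ∧
      (∀ n x, h n (Finsupp.single x 1) ∈ K n x (n + 1)) ∧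
      ∀ n c, tupleBoundary Y (n + 1) (h (n + 1) c) = t (n + 1) c - h n (tupleBoundary X n c) := by
  -- Again the last clause is the vanishing of the obstruction to the next lift; for the start `h =
  -- 0` it holds because `t 0 = 0`.
  let S : ℕ → Type _ := fun n => {h : TupleChain X n →ₗ[ℝ] TupleChain Y (n + 1) //
    IsTupleEquivariant Γ h ∧ (∀ x, h (Finsupp.single x 1) ∈ K n x (n + 1)) ∧
    ∀ c, tupleBoundary Y n (t (n + 1) c - h (tupleBoundary X n c)) = 0}
  have step : ∀ n (s : S n), ∃ s' : S (n + 1),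
      ∀ c, tupleBoundary Y (n + 1) (s'.1 c) = t (n + 1) c - s.1 (tupleBoundary X n c) := by
    rintro n ⟨h, h1, h2, h3⟩
    obtain ⟨F, hF1, hF2, hF3⟩ := exists_equivariant_lift (Γ := Γ) hfree
      (Φ := fun x => K (n + 1) x (n + 2)) (fun γ x c hc => hK.equivariant γ _ x _ c hc)
      (f := t (n + 1) - h ∘ₗ tupleBoundary X n)
      (fun γ c => by
        simp only [LinearMap.sub_apply, LinearMap.comp_apply, tupleBoundary_tupleRep, h1 γ,
          hte (n + 1) γ, map_sub])
      (fun x => hK.exists_boundary _ x n _ (Submodule.sub_mem _ (htK n x)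
        (tupleBoundary_single_mem fun j => hK.mono _ x j _ (h2 _))) (h3 _))
    have hF4 := fun c => LinearMap.congr_fun hF3 c
    simp only [LinearMap.comp_apply, LinearMap.sub_apply] at hF4
    refine ⟨⟨F, hF1, hF2, fun c => ?_⟩, hF4⟩
    rw [map_sub, hF4, htb, tupleBoundary_tupleBoundary, map_zero, sub_zero, sub_self]
  obtain ⟨s, -, hs⟩ := exists_dependent_seq (S := S)
    ⟨0, fun γ c => by simp, fun x => by simp, fun c => by simp [htb, ht0]⟩ step
  exact ⟨fun n => (s n).1, fun n => (s n).2.1, fun n => (s n).2.2.1, hs⟩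

end Equivariant

/-! ### Antisymmetrization of tuple chains -/

/-- The antisymmetrization operator on tuple chains. -/
noncomputable def tupleAlt (X : Type*) (n : ℕ) : TupleChain X n →ₗ[ℝ] TupleChain X n :=
  Finsupp.linearCombination ℝ fun x : Fin n → X => (n.factorial : ℝ)⁻¹ •
    ∑ σ : Equiv.Perm (Fin n), ((Equiv.Perm.sign σ : ℤ) : ℝ) • Finsupp.single (x ∘ σ) (1 : ℝ)

lemma tupleAlt_single {X : Type*} {n : ℕ} (x : Fin n → X) :
    tupleAlt X n (Finsupp.single x 1) = (n.factorial : ℝ)⁻¹ •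
      ∑ σ : Equiv.Perm (Fin n), ((Equiv.Perm.sign σ : ℤ) : ℝ) • Finsupp.single (x ∘ σ) (1 : ℝ) := by
  simp [tupleAlt]

lemma tupleAlt_zero (X : Type*) : tupleAlt X 0 = LinearMap.id := by
  refine tupleChain_hom_ext fun x => ?_
  simp [tupleAlt_single, Subsingleton.elim (x ∘ _) x]

/-- The permutations of `Fin (n + 1)` that map `j` to `i` correspond to the permutations of the
complements of `j` and `i`. -/
def permOfSuccAbove {n : ℕ} (j : Fin (n + 1)) (p : Fin (n + 1) × Equiv.Perm (Fin n)) :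
    Equiv.Perm (Fin (n + 1)) :=
  p.1.cycleRange.symm * Equiv.Perm.decomposeFin.symm (0, p.2) * j.cycleRange

lemma permOfSuccAbove_self {n : ℕ} (j : Fin (n + 1)) (p : Fin (n + 1) × Equiv.Perm (Fin n)) :
    permOfSuccAbove j p j = p.1 := by
  simp [permOfSuccAbove]

lemma permOfSuccAbove_succAbove {n : ℕ} (j : Fin (n + 1)) (p : Fin (n + 1) × Equiv.Perm (Fin n))
    (a : Fin n) : permOfSuccAbove j p (j.succAbove a) = p.1.succAbove (p.2 a) := by
  simp [permOfSuccAbove]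

/-- Each of the two range cycles contributes (-1) to the power of its index, which are exactly the
signs of the two faces compared in `tupleBoundary_tupleAlt`. -/
lemma sign_permOfSuccAbove {n : ℕ} (j : Fin (n + 1)) (p : Fin (n + 1) × Equiv.Perm (Fin n)) :
    ((Equiv.Perm.sign (permOfSuccAbove j p) : ℤ) : ℝ) =
      (-1) ^ (j : ℕ) * (-1) ^ (p.1 : ℕ) * ((Equiv.Perm.sign p.2 : ℤ) : ℝ) := by
  simp [permOfSuccAbove, Equiv.Perm.sign_symm]
  ring

lemma bijective_permOfSuccAbove {n : ℕ} (j : Fin (n + 1)) :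
    Function.Bijective (permOfSuccAbove j) := by
  refine (Fintype.bijective_iff_injective_and_card _).2 ⟨fun p q h => ?_, ?_⟩
  · have h1 : p.1 = q.1 := by
      rw [← permOfSuccAbove_self j p, h, permOfSuccAbove_self]
    refine Prod.ext h1 (Equiv.ext fun a => ?_)
    have h2 := permOfSuccAbove_succAbove j p a
    rw [h, permOfSuccAbove_succAbove, h1] at h2
    exact (Fin.succAbove_right_injective h2).symm
  · simp [Fintype.card_perm, Nat.factorial_succ]

lemma tupleBoundary_tupleAlt {X : Type*} {n : ℕ} (c : TupleChain X (n + 1)) :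
    tupleBoundary X n (tupleAlt X (n + 1) c) = tupleAlt X n (tupleBoundary X n c) := by
  refine LinearMap.congr_fun (f := tupleBoundary X n ∘ₗ tupleAlt X (n + 1))
    (g := tupleAlt X n ∘ₗ tupleBoundary X n) (tupleChain_hom_ext fun x => ?_) c
  -- Sort the permutations by the deleted entry `i = σ j` and the permutation induced on the rest.
  -- The result does not depend on `j`, so the sum over `j` gives a factor `n + 1`, which turns
  -- 1/(n+1)! into 1/n!.
  have key : ∀ j : Fin (n + 1), ∑ σ : Equiv.Perm (Fin (n + 1)), ((Equiv.Perm.sign σ : ℤ) : ℝ) •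
      (-1 : ℝ) ^ (j : ℕ) • Finsupp.single (fun a => (x ∘ σ) (j.succAbove a)) (1 : ℝ) =
      ∑ i : Fin (n + 1), (-1 : ℝ) ^ (i : ℕ) • ∑ τ : Equiv.Perm (Fin n),
        ((Equiv.Perm.sign τ : ℤ) : ℝ) •
          Finsupp.single ((fun a => x (i.succAbove a)) ∘ τ) (1 : ℝ) := by
    intro j
    simp only [Finset.smul_sum]
    rw [← Fintype.sum_prod_type', ← (bijective_permOfSuccAbove j).sum_comp]
    refine Finset.sum_congr rfl fun p _ => ?_
    rw [smul_smul, smul_smul, sign_permOfSuccAbove]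
    congr 1
    · have : ((-1 : ℝ) ^ (j : ℕ)) * (-1 : ℝ) ^ (j : ℕ) = 1 := by
        rw [← mul_pow]
        simp
      linear_combination ((-1) ^ (p.1 : ℕ) * ((Equiv.Perm.sign p.2 : ℤ) : ℝ)) * this
    · congr 1
      funext a
      simp [permOfSuccAbove_succAbove]
  simp only [LinearMap.comp_apply, tupleAlt_single, tupleBoundary_single, map_sum, map_smul,
    Finset.smul_sum (r := ((Equiv.Perm.sign _ : ℤ) : ℝ))]
  rw [Finset.sum_comm]
  simp only [key]
  rw [Finset.sum_const, Finset.card_univ, Fintype.card_fin]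
  simp only [smul_comm _ ((n.factorial : ℝ)⁻¹)]
  rw [← Finset.smul_sum, ← Nat.cast_smul_eq_nsmul ℝ, smul_smul]
  congr 1
  rw [Nat.factorial_succ]
  push_cast
  have : (n : ℝ) + 1 ≠ 0 := by positivity
  field_simp

lemma tupleAlt_single_of_not_injective {X : Type*} {n : ℕ} {x : Fin n → X}
    (hx : ¬ Function.Injective x) : tupleAlt X n (Finsupp.single x 1) = 0 := by
  simp only [Function.Injective, not_forall] at hx
  obtain ⟨a, b, hab, hne⟩ := hx
  rw [tupleAlt_single]
  have hs : x ∘ Equiv.swap a b = x := by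
    funext c
    simp only [Function.comp_apply, Equiv.swap_apply_def]
    split_ifs with h1 h2
    · rw [h1, hab]
    · rw [h2, hab]
    · rfl
  set s := ∑ σ : Equiv.Perm (Fin n), ((Equiv.Perm.sign σ : ℤ) : ℝ) • Finsupp.single (x ∘ σ) (1 : ℝ)
    with hsdef
  -- The transposition of two positions with equal entries fixes the tuple and reverses all signs.
  have h : s = -s := by
    conv_lhs => rw [hsdef, ← Equiv.sum_comp (Equiv.mulLeft (Equiv.swap a b))]
    rw [hsdef, ← Finset.sum_neg_distrib]
    refine Finset.sum_congr rfl fun σ _ => ?_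
    rw [← neg_smul, Equiv.coe_mulLeft, Equiv.Perm.coe_mul, ← Function.comp_assoc, hs]
    simp [Equiv.Perm.sign_swap hne]
  rw [self_eq_neg.1 h, smul_zero]

lemma tupleAlt_tupleMap {X Y : Type*} (f : X → Y) {n : ℕ} (c : TupleChain X n) :
    tupleAlt Y n (tupleMap f n c) = tupleMap f n (tupleAlt X n c) := by
  refine LinearMap.congr_fun (f := tupleAlt Y n ∘ₗ tupleMap f n)
    (g := tupleMap f n ∘ₗ tupleAlt X n) (tupleChain_hom_ext fun x => ?_) c
  simp only [LinearMap.comp_apply, tupleMap_single, tupleAlt_single, map_sum, map_smul]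
  rfl

lemma tupleAlt_single_mem {X M : Type*} [AddCommGroup M] [Module ℝ M] {n : ℕ}
    {F : TupleChain X n →ₗ[ℝ] M} {N : Submodule ℝ M} {x : Fin n → X}
    (h : ∀ σ : Equiv.Perm (Fin n), F (Finsupp.single (x ∘ σ) 1) ∈ N) :
    F (tupleAlt X n (Finsupp.single x 1)) ∈ N := by
  rw [tupleAlt_single, map_smul, map_sum]
  refine Submodule.smul_mem _ _ (Submodule.sum_mem _ fun σ _ => ?_)
  rw [map_smul]
  exact Submodule.smul_mem _ _ (h σ)

/-! ### Acyclicity of dismantlable clique complexes -/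

/-- The tuples in `T` whose entries are pairwise related. -/
def cliqueTuples {Y : Type*} (R : Y → Y → Prop) (T : Set Y) (n : ℕ) : Set (Fin n → Y) :=
  {y | (∀ j, y j ∈ T) ∧ ∀ j k, R (y j) (y k)}

/-- The tuple chains supported on the pairwise related tuples in `T`. -/
abbrev cliqueChains {Y : Type*} (R : Y → Y → Prop) (T : Set Y) (n : ℕ) :
    Submodule ℝ (TupleChain Y n) :=
  Finsupp.supported ℝ ℝ (cliqueTuples R T n)

lemma mem_supported_of_subset {B : Type*} {s t : Set B} {c : B →₀ ℝ}
    (hc : c ∈ Finsupp.supported ℝ ℝ s) (h : ∀ y ∈ s, y ∈ t) : c ∈ Finsupp.supported ℝ ℝ t :=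
  Finsupp.supported_mono h hc

lemma tupleCone_mem_supported {Y : Type*} {n : ℕ} {s : Set (Fin n → Y)} {t : Set (Fin (n + 1) → Y)}
    {p : Y} (h : ∀ x ∈ s, (Fin.cons p x : Fin (n + 1) → Y) ∈ t) {c : TupleChain Y n}
    (hc : c ∈ Finsupp.supported ℝ ℝ s) : tupleCone p n c ∈ Finsupp.supported ℝ ℝ t := by
  refine mem_of_mem_supported (fun x hx => ?_) hc
  rw [tupleCone_single]
  exact Finsupp.single_mem_supported _ _ (h x hx)

/-- The full simplices on the vertices of `x` and their images under `f` form an acyclic carrier. -/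
lemma isAcyclicCarrier_image {Y : Type*} (f : Y → Y) :
    IsAcyclicCarrier (⊥ : Subgroup (Equiv.Perm Y)) (X := Y) (Y := Y) fun m x n =>
      Finsupp.supported ℝ ℝ {y : Fin n → Y | ∀ j, ∃ i : Fin m, y j = x i ∨ y j = f (x i)} where
  mono m x j n := Finsupp.supported_mono fun y hy l => by
    obtain ⟨i, hi⟩ := hy l
    exact ⟨_, hi⟩
  equivariant γ m x n c hc := by
    obtain rfl := Subsingleton.elim γ 1
    simpa using hc
  exists_boundary m x n c hc h0 := by
    refine ⟨tupleCone (x 0) (n + 1) c, tupleCone_mem_supported (fun y hy j => ?_) hc, ?_⟩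
    · refine Fin.cases ⟨0, Or.inl rfl⟩ (fun j => ?_) j
      simpa using hy j
    · rw [tupleBoundary_tupleCone, h0, map_zero, sub_zero]

/-- If any finite subset of `T` either lies in a simplex of the clique complex, or has a vertex that
is dominated by a vertex of smaller weight, then the clique complex of `T` is acyclic. -/
theorem exists_boundary_of_dismantlable {Y : Type*} {R : Y → Y → Prop} (hrefl : ∀ x, R x x)
    (hsymm : ∀ x y, R x y → R y x) {T : Set Y} {μ : Y → ℕ}
    (hT : ∀ F : Finset Y, (F : Set Y) ⊆ T →
      (∃ p ∈ T, ∀ x ∈ F, R p x) ∨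
      ∃ x ∈ F, ∃ x' ∈ T, μ x' < μ x ∧ ∀ y ∈ F, R x y → R x' y)
    {n : ℕ} {c : TupleChain Y (n + 1)} (hc : c ∈ cliqueChains R T (n + 1))
    (h0 : tupleBoundary Y n c = 0) :
    ∃ b ∈ cliqueChains R T (n + 2), tupleBoundary Y (n + 1) b = c := by
  classical
  -- Induction on the total weight of a finite vertex set carrying the cycle. Only the cycle is
  -- confined to `F`; the filling may use all of `T`.
  have main : ∀ (N : ℕ) (F : Finset Y), (F : Set Y) ⊆ T → ∑ x ∈ F, μ x = N →
      ∀ c ∈ cliqueChains R (F : Set Y) (n + 1), tupleBoundary Y n c = 0 →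
        ∃ b ∈ cliqueChains R T (n + 2), tupleBoundary Y (n + 1) b = c := by
    intro N
    induction N using Nat.strong_induction_on with
    | _ N ih =>
    intro F hFT hN c hc h0
    rcases hT F hFT with ⟨p, hp, hpF⟩ | ⟨x, hx, x', hx', hμ, hdom⟩
    · refine ⟨tupleCone p (n + 1) c, tupleCone_mem_supported (t := cliqueTuples R T (n + 2))
        (fun y hy => ⟨fun j => ?_, fun j k => ?_⟩) hc, ?_⟩
      · refine Fin.cases hp (fun j => ?_) j
        exact hFT (hy.1 j)
      · refine Fin.cases ?_ (fun j => ?_) j <;> refine Fin.cases ?_ (fun k => ?_) k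
        · exact hrefl p
        · exact hpF _ (hy.1 k)
        · exact hsymm _ _ (hpF _ (hy.1 j))
        · exact hy.2 j k
      · rw [tupleBoundary_tupleCone, h0, map_zero, sub_zero]
    · let f : Y → Y := fun y => if y = x then x' else y
      have hf : ∀ y ∈ F, ∀ z ∈ F, R y z → R (f y) z := by
        intro y hy z hz hyz
        simp only [f]
        split_ifs with h
        · exact hdom z hz (h ▸ hyz)
        · exact hyz
      have hff : ∀ y ∈ F, ∀ z ∈ F, R y z → R (f y) (f z) := by
        intro y hy z hz hyz
        by_cases h : y = x
        · by_cases h' : z = x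
          · simp only [f, h, h', if_true]
            exact hrefl _
          · simpa only [f, h', if_false] using hf y hy z hz hyz
        · simpa only [f, h, if_false] using hsymm _ _ (hf z hz y hy (hsymm _ _ hyz))
      have hfT : ∀ y ∈ F, f y ∈ T := by
        intro y hy
        simp only [f]
        split_ifs
        · exact hx'
        · exact hFT hy
      -- Moving `x` to `x'` is homotopic to the identity within the simplices spanned by a tuple and
      -- its image; these are cliques by domination. The group is trivial here, so equivariance is
      -- void.
      obtain ⟨h, -, hh, hhb⟩ := (isAcyclicCarrier_image f).exists_homotopy
        (t := fun n => LinearMap.id - tupleMap f n) (fun γ _ _ => Subsingleton.elim γ 1)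
        (tupleChain_hom_ext fun y => by
          simp [tupleMap_single, Subsingleton.elim (f ∘ y) y])
        (fun n c => by simp [tupleBoundary_tupleMap])
        (fun n γ c => by
          obtain rfl := Subsingleton.elim γ 1
          simp)
        (fun n y => by
          simp only [LinearMap.sub_apply, LinearMap.id_apply, tupleMap_single]
          exact Submodule.sub_mem _
            (Finsupp.single_mem_supported _ _ fun j => ⟨j, Or.inl rfl⟩)
            (Finsupp.single_mem_supported _ _ fun j => ⟨j, Or.inr rfl⟩))
      have hhc : h (n + 1) c ∈ cliqueChains R T (n + 2) := by
        refine mem_of_mem_supported (fun y hy => ?_) hc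
        refine Finsupp.supported_mono ?_ (hh (n + 1) y)
        intro z hz
        refine ⟨fun j => ?_, fun j k => ?_⟩
        · obtain ⟨i, hi | hi⟩ := hz j
          · exact hi ▸ hFT (hy.1 i)
          · exact hi ▸ hfT _ (hy.1 i)
        · obtain ⟨i, hi⟩ := hz j
          obtain ⟨l, hl⟩ := hz k
          have hi' := hy.1 i
          have hl' := hy.1 l
          rcases hi with hi | hi <;> rcases hl with hl | hl <;> rw [hi, hl]
          · exact hy.2 i l
          · exact hsymm _ _ (hf _ hl' _ hi' (hy.2 l i))
          · exact hf _ hi' _ hl' (hy.2 i l)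
          · exact hff _ hi' _ hl' (hy.2 i l)
      have hF'T : ((insert x' (F.erase x) : Finset Y) : Set Y) ⊆ T := by
        intro y hy
        rcases Finset.mem_insert.1 hy with rfl | hy
        · exact hx'
        · exact hFT (Finset.mem_of_mem_erase hy)
      -- The moved cycle lives on this set, whose weight is smaller whether or not `x'` was already
      -- in `F`.
      have hlt : ∑ y ∈ insert x' (F.erase x), μ y < N := by
        rw [← hN, ← Finset.add_sum_erase F μ hx]
        by_cases h : x' ∈ F.erase x
        · rw [Finset.insert_eq_of_mem h]
          omega
        · rw [Finset.sum_insert h]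
          omega
      obtain ⟨b, hb, hbc⟩ := ih _ hlt _ hF'T rfl (tupleMap f (n + 1) c)
        (mem_of_mem_supported (fun y hy => by
          rw [tupleMap_single]
          refine Finsupp.single_mem_supported _ _ ⟨fun j => ?_, fun j k => ?_⟩
          · simp only [f, Function.comp_apply, Finset.coe_insert]
            split_ifs with h
            · exact Or.inl rfl
            · exact Or.inr (Finset.mem_coe.2 (Finset.mem_erase.2 ⟨h, hy.1 j⟩))
          · exact hff _ (hy.1 j) _ (hy.1 k) (hy.2 j k)) hc)
        (by rw [tupleBoundary_tupleMap, h0, map_zero])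
      refine ⟨b + h (n + 1) c, Submodule.add_mem _ hb hhc, ?_⟩
      rw [map_add, hbc, hhb, h0, map_zero, sub_zero, LinearMap.sub_apply, LinearMap.id_apply]
      abel
  refine main _ (c.support.biUnion fun y => Finset.univ.image y) ?_ rfl c ?_ h0
  · intro y hy
    simp only [Finset.coe_biUnion, Set.mem_iUnion, Finset.mem_coe, Finset.coe_image,
      Finset.coe_univ, Set.image_univ, Set.mem_range] at hy
    obtain ⟨z, hz, j, rfl⟩ := hy
    exact (hc hz).1 j
  · intro y hy
    refine ⟨fun j => ?_, (hc hy).2⟩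
    exact Finset.mem_coe.2 (Finset.mem_biUnion.2 ⟨y, hy, Finset.mem_image_of_mem _ (Finset.mem_univ j)⟩)

/-! ### Graph metrics -/

section Graph

open SimpleGraph

variable {A : Type*} {G : SimpleGraph A}

lemma exists_dist_le_of_le_dist (hG : G.Connected) {u v : A} {k : ℕ} (hk : k ≤ G.dist u v) :
    ∃ w, G.dist u w ≤ k ∧ G.dist w v + k ≤ G.dist u v := by
  obtain ⟨p, hp⟩ := hG.exists_walk_length_eq_dist u v
  refine ⟨p.getVert k, ?_, ?_⟩
  · refine (dist_le (p.take k)).trans ?_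
    rw [Walk.take_length]
    exact min_le_left _ _
  · have := dist_le (p.drop k)
    rw [Walk.drop_length] at this
    omega

/-- The four-point inequality of a Gromov hyperbolic graph, with an integral constant. -/
lemma IsGromovHyperbolic.exists_four_point (hG : IsGromovHyperbolic G) :
    ∃ s : ℕ, ∀ a b c w : A, G.dist a c + G.dist b w ≤
      max (G.dist a b + G.dist c w) (G.dist b c + G.dist a w) + s := by
  obtain ⟨-, δ, hδ⟩ := hG
  -- Clearing the factor 1/2 in the Gromov products doubles `δ`.
  obtain ⟨s, hs⟩ := exists_nat_ge (2 * δ)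
  refine ⟨s, fun a b c w => ?_⟩
  have h := hδ w a b c
  simp only [gromovProduct] at h
  rify
  rw [← max_add_add_right, le_max_iff]
  rw [sub_le_iff_le_add, min_le_iff] at h
  rcases h with h | h
  · left; linarith
  · right; linarith

lemma dist_map_le {B : Type*} {H : SimpleGraph B} (hG : G.Connected) (f : G →g H) (u v : A) :
    H.dist (f u) (f v) ≤ G.dist u v := by
  obtain ⟨p, hp⟩ := hG.exists_walk_length_eq_dist u v
  rw [← hp, ← Walk.length_map f]
  exact dist_le _

lemma edist_map_le {B : Type*} {H : SimpleGraph B} (f : G →g H) (u v : A) :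
    H.edist (f u) (f v) ≤ G.edist u v := by
  by_cases h : G.edist u v = ⊤
  · rw [h]; exact le_top
  · obtain ⟨p, hp⟩ := exists_walk_of_edist_ne_top h
    rw [← hp, ← Walk.length_map f]
    exact edist_le _

/-- The Rips complex of a hyperbolic graph, for a large scale, is acyclic. -/
theorem exists_boundary_of_four_point (hG : G.Connected) {s : ℕ}
    (hs : ∀ a b c w : A, G.dist a c + G.dist b w ≤
      max (G.dist a b + G.dist c w) (G.dist b c + G.dist a w) + s)
    {n : ℕ} {c : TupleChain A (n + 1)}
    (hc : c ∈ cliqueChains (fun x y => G.dist x y ≤ 2 * (s + 1)) Set.univ (n + 1))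
    (h0 : tupleBoundary A n c = 0) :
    ∃ b ∈ cliqueChains (fun x y => G.dist x y ≤ 2 * (s + 1)) Set.univ (n + 2),
      tupleBoundary A (n + 1) b = c := by
  obtain ⟨p⟩ := hG.nonempty
  refine exists_boundary_of_dismantlable (μ := fun x => G.dist x p) (fun x => by simp)
    (fun x y h => by rwa [dist_comm]) (fun F _ => ?_) hc h0
  by_cases hF : ∀ x ∈ F, G.dist p x ≤ 2 * (s + 1)
  · exact Or.inl ⟨p, trivial, hF⟩
  right
  push Not at hF
  obtain ⟨z, hz, hzp⟩ := hF
  obtain ⟨x, hx, hxmax⟩ := F.exists_max_image (fun x => G.dist x p) ⟨z, hz⟩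
  have hxp : 2 * (s + 1) < G.dist x p := by
    have := hxmax z hz
    rw [dist_comm] at hzp
    omega
  -- The vertex farthest from `p` moves `s + 1` along a geodesic towards `p`. Either term of the
  -- four-point maximum then bounds the distance from `x'` to a neighbour of `x` in `F` by `2 * s +
  -- 1`.
  obtain ⟨x', h1, h2⟩ := exists_dist_le_of_le_dist hG (u := x) (v := p) (k := s + 1) (by omega)
  refine ⟨x, hx, x', trivial, by omega, fun y hy hxy => ?_⟩
  have h3 := hs x' x y p
  have h4 := hxmax y hy
  rw [dist_comm (u := x') (v := x)] at h3
  omega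

end Graph

/-! ### Geometry of the cusped graph -/

section Cusped

open SimpleGraph Pointwise

variable {Γ : Type u} {I : Type v}

namespace CuspedVertex

/-- The height of a vertex of the cusped graph. -/
def height : CuspedVertex Γ I → ℕ
  | base _ => 0
  | deep _ _ n => n + 1

/-- The element of the group below a vertex of the cusped graph. -/
def proj : CuspedVertex Γ I → Γ
  | base g => g
  | deep g _ _ => g

lemma height_cuspedVertex (i : I) (p : Γ × ℕ) : (cuspedVertex i p).height = p.2 := by
  obtain ⟨g, _ | n⟩ := p <;> rfl

lemma proj_cuspedVertex (i : I) (p : Γ × ℕ) : (cuspedVertex i p).proj = p.1 := by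
  obtain ⟨g, _ | n⟩ := p <;> rfl

variable [Group Γ]

instance : MulAction Γ (CuspedVertex Γ I) where
  smul γ x := match x with
    | base g => base (γ * g)
    | deep g i n => deep (γ * g) i n
  one_smul x := by
    cases x with
    | base g => exact congrArg base (one_mul g)
    | deep g i n => exact congrArg (deep · i n) (one_mul g)
  mul_smul γ₁ γ₂ x := by
    cases x with
    | base g => exact congrArg base (mul_assoc γ₁ γ₂ g)
    | deep g i n => exact congrArg (deep · i n) (mul_assoc γ₁ γ₂ g)

lemma proj_smul (γ : Γ) (x : CuspedVertex Γ I) : (γ • x).proj = γ * x.proj := by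
  cases x <;> rfl

lemma height_smul (γ : Γ) (x : CuspedVertex Γ I) : (γ • x).height = x.height := by
  cases x <;> rfl

lemma smul_cuspedVertex (γ : Γ) (i : I) (p : Γ × ℕ) :
    γ • cuspedVertex i p = cuspedVertex i (γ * p.1, p.2) := by
  obtain ⟨g, _ | n⟩ := p <;> rfl

end CuspedVertex

open CuspedVertex

variable [Group Γ] {P : I → Subgroup Γ} {S : Set Γ}

lemma cuspedGraph_adj_iff {u v : CuspedVertex Γ I} : (cuspedGraph P S).Adj u v ↔
    u ≠ v ∧ ((∃ g h, (mulCayley S).Adj g h ∧ base g = u ∧ base h = v) ∨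
      ∃ i p q, (horoball (mulCayley (S ∩ (P i : Set Γ)))).Adj p q ∧
        cuspedVertex i p = u ∧ cuspedVertex i q = v) := by
  simp only [cuspedGraph, sup_adj, iSup_adj, map_adj', and_or_left]
  simp

/-- Left translation of a Cayley graph. -/
def mulCayleyTranslate (S : Set Γ) (γ : Γ) : mulCayley S →g mulCayley S where
  toFun g := γ * g
  map_rel' {g h} H := by
    rw [mulCayley_adj'] at H ⊢
    obtain ⟨h1, s, hs, h2⟩ := H
    refine ⟨fun h => h1 (mul_left_cancel h), s, hs, ?_⟩
    simpa [mul_assoc] using h2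

/-- Left translation of the cusped graph. -/
def cuspedTranslate (P : I → Subgroup Γ) (S : Set Γ) (γ : Γ) :
    cuspedGraph P S →g cuspedGraph P S where
  toFun x := γ • x
  map_rel' {x y} H := by
    rw [cuspedGraph_adj_iff] at H ⊢
    obtain ⟨hne, H⟩ := H
    refine ⟨fun h => hne (MulAction.injective γ h), ?_⟩
    rcases H with ⟨g, h, H, rfl, rfl⟩ | ⟨i, p, q, H, rfl, rfl⟩
    · exact Or.inl ⟨γ * g, γ * h, (mulCayleyTranslate S γ).map_adj H, rfl, rfl⟩
    · refine Or.inr ⟨i, (γ * p.1, p.2), (γ * q.1, q.2), ?_, (smul_cuspedVertex γ i p).symm,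
        (smul_cuspedVertex γ i q).symm⟩
      rcases H with ⟨h1, h2, h3⟩ | ⟨h1, h2⟩ | ⟨h1, h2, h3, h4⟩
      · exact Or.inl ⟨h1, h2, (mulCayleyTranslate _ γ).map_adj h3⟩
      · exact Or.inr (Or.inl ⟨congrArg (γ * ·) h1, h2⟩)
      · exact Or.inr (Or.inr ⟨h1, h2, fun h => h3 (mul_left_cancel h),
          (edist_map_le (mulCayleyTranslate _ γ) p.1 q.1).trans h4⟩)

lemma dist_smul (hG : (cuspedGraph P S).Connected) (γ : Γ) (x y : CuspedVertex Γ I) :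
    (cuspedGraph P S).dist (γ • x) (γ • y) = (cuspedGraph P S).dist x y := by
  refine le_antisymm (dist_map_le hG (cuspedTranslate P S γ) x y) ?_
  have := dist_map_le hG (cuspedTranslate P S γ⁻¹) (γ • x) (γ • y)
  simpa [cuspedTranslate] using this

/-! #### Cayley graphs -/

lemma inv_mul_mem_of_mulCayley_adj {T : Set Γ} (hT : ∀ s ∈ T, s⁻¹ ∈ T) {g h : Γ}
    (H : (mulCayley T).Adj g h) : g⁻¹ * h ∈ T := by
  rw [mulCayley_adj'] at H
  obtain ⟨-, s, hs, rfl | rfl⟩ := H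
  · simpa using hs
  · simpa using hT s hs

lemma inv_mul_mem_pow_of_walk {T : Set Γ} (hT : ∀ s ∈ T, s⁻¹ ∈ T) {g h : Γ}
    (p : (mulCayley T).Walk g h) : g⁻¹ * h ∈ (insert 1 T) ^ p.length := by
  induction p with
  | nil => simp
  | @cons a b c H p ih =>
    rw [Walk.length_cons, pow_succ', Set.mem_mul]
    exact ⟨a⁻¹ * b, Set.mem_insert_of_mem _ (inv_mul_mem_of_mulCayley_adj hT H), _, ih, by group⟩

lemma inv_mul_mem_subgroup_of_walk {T : Set Γ} (hT : ∀ s ∈ T, s⁻¹ ∈ T) {H : Subgroup Γ}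
    (hTH : T ⊆ H) {g h : Γ} (p : (mulCayley T).Walk g h) : g⁻¹ * h ∈ H := by
  induction p with
  | nil => simp
  | @cons a b c H' p ih =>
    have := H.mul_mem (hTH (inv_mul_mem_of_mulCayley_adj hT H')) ih
    simpa [mul_assoc] using this

lemma mulCayley_reachable {T : Set Γ} {k : Γ} (hk : k ∈ Subgroup.closure T) :
    ∀ g, (mulCayley T).Reachable g (g * k) := by
  induction hk using Subgroup.closure_induction with
  | mem s hs =>
    intro g
    by_cases h : g = g * s
    · rw [← h]
    · exact Adj.reachable ((mulCayley_adj' _ _ _).2 ⟨h, s, hs, Or.inl rfl⟩)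
  | one =>
    intro g
    rw [mul_one]
  | mul x y _ _ hx hy =>
    intro g
    rw [← mul_assoc]
    exact (hx g).trans (hy _)
  | inv x _ hx =>
    intro g
    simpa using (hx (g * x⁻¹)).symm

lemma pow_mem_pow_of_le {T : Set Γ} {m n : ℕ} (h : m ≤ n) {g : Γ} (hg : g ∈ (insert 1 T) ^ m) :
    g ∈ (insert 1 T) ^ n :=
  Set.pow_subset_pow_right (Set.mem_insert 1 T) h hg

/-! #### Adjacency in the cusped graph -/

lemma IsCompatible.inter_inv_mem (hS : IsCompatible P S) (i : I) :
    ∀ s ∈ S ∩ (P i : Set Γ), s⁻¹ ∈ S ∩ (P i : Set Γ) :=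
  fun s hs => ⟨hS.inv_mem s hs.1, (P i).inv_mem hs.2⟩

lemma height_le_of_adj {x y : CuspedVertex Γ I} (H : (cuspedGraph P S).Adj x y) :
    y.height ≤ x.height + 1 := by
  rw [cuspedGraph_adj_iff] at H
  obtain ⟨-, ⟨g, h, H, rfl, rfl⟩ | ⟨i, p, q, H, rfl, rfl⟩⟩ := H
  · simp [height]
  · rw [height_cuspedVertex, height_cuspedVertex]
    rcases H with ⟨h1, h2, h3⟩ | ⟨h1, h2⟩ | ⟨h1, h2, h3, h4⟩ <;> omega

/-- Vertical edges do not move the projection, and a horizontal edge of height n moves it by a word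
of length at most 2^n. This is the source of finiteness at bounded height. -/
lemma inv_mul_mem_of_adj (hS : IsCompatible P S) {x y : CuspedVertex Γ I}
    (H : (cuspedGraph P S).Adj x y) : x.proj⁻¹ * y.proj ∈ (insert 1 S) ^ 2 ^ x.height := by
  rw [cuspedGraph_adj_iff] at H
  obtain ⟨-, ⟨g, h, H, rfl, rfl⟩ | ⟨i, p, q, H, rfl, rfl⟩⟩ := H
  · simpa [height, proj] using Or.inr (inv_mul_mem_of_mulCayley_adj hS.inv_mem H)
  · simp only [height_cuspedVertex, proj_cuspedVertex]
    rcases H with ⟨h1, h2, h3⟩ | ⟨h1, h2⟩ | ⟨h1, h2, h3, h4⟩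
    · rw [h1, pow_zero, pow_one]
      exact Or.inr (inv_mul_mem_of_mulCayley_adj (hS.inter_inv_mem i) h3).1
    · rw [h1, inv_mul_cancel]
      exact pow_mem_pow_of_le (Nat.zero_le _) (by simp)
    · have hne : (mulCayley (S ∩ (P i : Set Γ))).edist p.1 q.1 ≠ ⊤ :=
        ne_top_of_le_ne_top (by exact_mod_cast ENat.natCast_ne_top (2 ^ p.2)) h4
      obtain ⟨w, hw⟩ := exists_walk_of_edist_ne_top hne
      have h5 : w.length ≤ 2 ^ p.2 := by
        rw [← hw] at h4
        exact_mod_cast h4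
      refine pow_mem_pow_of_le h5 (Set.pow_subset_pow_left ?_
        (inv_mul_mem_pow_of_walk (hS.inter_inv_mem i) w))
      exact Set.insert_subset_insert Set.inter_subset_left

lemma adj_deep_succ (g : Γ) (i : I) (n : ℕ) :
    (cuspedGraph P S).Adj (deep g i n) (deep g i (n + 1)) :=
  cuspedGraph_adj_iff.2 ⟨by simp, Or.inr ⟨i, (g, n + 1), (g, n + 2),
    Or.inr (Or.inl ⟨rfl, Or.inl rfl⟩), rfl, rfl⟩⟩

/-- `deep g i (n + 1)` has height `n + 2`, so one edge cannot reach the base, where different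
horoballs meet. -/
lemma eq_deep_of_adj (hS : IsCompatible P S) {g : Γ} {i : I} {n : ℕ} {y : CuspedVertex Γ I}
    (H : (cuspedGraph P S).Adj (deep g i (n + 1)) y) :
    ∃ h m, y = deep h i m ∧ n ≤ m ∧ g⁻¹ * h ∈ P i := by
  rw [cuspedGraph_adj_iff] at H
  obtain ⟨-, ⟨g, h, H, h1, -⟩ | ⟨j, ⟨a, k⟩, ⟨b, l⟩, H, h1, rfl⟩⟩ := H
  · cases h1
  · cases k with
    | zero => cases h1
    | succ k =>
    cases h1
    rcases H with ⟨h1, h2, h3⟩ | ⟨h1, h2⟩ | ⟨h1, h2, h3, h4⟩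
    · cases h1
    · simp only at h1 h2
      subst h1
      cases l with
      | zero => omega
      | succ l => exact ⟨a, l, rfl, by omega, by simp⟩
    · simp only at h1 h4
      subst h1
      have hne : (mulCayley (S ∩ (P i : Set Γ))).edist a b ≠ ⊤ :=
        ne_top_of_le_ne_top (by exact_mod_cast ENat.natCast_ne_top (2 ^ (n + 1 + 1))) h4
      obtain ⟨w, -⟩ := exists_walk_of_edist_ne_top hne
      exact ⟨b, n + 1, rfl, by omega,
        inv_mul_mem_subgroup_of_walk (hS.inter_inv_mem i) Set.inter_subset_right w⟩

/-- Two points of a coset of `P i` are eventually adjacent or equal in the horoball. -/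
lemma eventually_dist_deep_le_one (hS : IsCompatible P S) {i : I} {g h : Γ}
    (hgh : g⁻¹ * h ∈ P i) :
    ∀ᶠ n in Filter.atTop, (cuspedGraph P S).dist (deep g i n) (deep h i n) ≤ 1 := by
  rcases eq_or_ne g h with rfl | hne
  · simp
  rw [← hS.closure_inter_eq i] at hgh
  have hr := mulCayley_reachable hgh g
  rw [mul_inv_cancel_left] at hr
  obtain ⟨w, hw⟩ := hr.exists_walk_length_eq_edist
  filter_upwards [Filter.eventually_ge_atTop w.length] with n hn
  refine (dist_eq_one_iff_adj.2 (cuspedGraph_adj_iff.2 ⟨?_, Or.inr ⟨i, (g, n + 1), (h, n + 1),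
    Or.inr (Or.inr ⟨rfl, by simp, hne, ?_⟩), rfl, rfl⟩⟩)).le
  · intro H
    cases H
    exact hne rfl
  · simp only
    rw [← hw]
    have : w.length ≤ 2 ^ (n + 1) := hn.trans ((Nat.le_succ n).trans Nat.lt_two_pow_self.le)
    exact_mod_cast this

/-! #### Distances in the cusped graph -/

lemma height_le_add_dist (hG : (cuspedGraph P S).Connected) (x y : CuspedVertex Γ I) :
    y.height ≤ x.height + (cuspedGraph P S).dist x y := by
  obtain ⟨p, hp⟩ := hG.exists_walk_length_eq_dist x y
  rw [← hp]
  clear hp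
  induction p with
  | nil => simp
  | cons H p ih =>
    have := height_le_of_adj H
    rw [Walk.length_cons]
    omega

lemma dist_deep_add_le (g : Γ) (i : I) (n k : ℕ) (hG : (cuspedGraph P S).Connected) :
    (cuspedGraph P S).dist (deep g i n) (deep g i (n + k)) ≤ k := by
  induction k with
  | zero => simp
  | succ k ih =>
    have h1 := hG.dist_triangle (u := deep g i n) (v := deep g i (n + k))
      (w := deep g i (n + k + 1))
    have h2 := dist_eq_one_iff_adj.2 (adj_deep_succ (P := P) (S := S) g i (n + k))
    rw [← add_assoc]
    omega

/-- The start has height `n + 1` and each edge descends by at most one, so `n` edges cannot leave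
the horoball. -/
lemma eq_deep_of_walk (hS : IsCompatible P S) {x y : CuspedVertex Γ I}
    (p : (cuspedGraph P S).Walk x y) {g : Γ} {i : I} {n : ℕ} (hx : x = deep g i n)
    (hp : p.length ≤ n) : ∃ h m, y = deep h i m ∧ g⁻¹ * h ∈ P i := by
  induction p generalizing g n with
  | nil => exact ⟨g, n, hx, by simp⟩
  | cons H p ih =>
    rw [Walk.length_cons] at hp
    obtain ⟨n, rfl⟩ : ∃ k, n = k + 1 := ⟨n - 1, by omega⟩
    subst hx
    obtain ⟨h, m, rfl, hm, hgh⟩ := eq_deep_of_adj hS H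
    obtain ⟨k, l, rfl, hhk⟩ := ih rfl (by omega)
    refine ⟨k, l, rfl, ?_⟩
    have := (P i).mul_mem hgh hhk
    simpa [mul_assoc] using this

lemma eq_deep_of_dist_le (hS : IsCompatible P S) (hG : (cuspedGraph P S).Connected) {g : Γ} {i : I}
    {n : ℕ} {y : CuspedVertex Γ I} (h : (cuspedGraph P S).dist (deep g i n) y ≤ n) :
    ∃ h m, y = deep h i m ∧ g⁻¹ * h ∈ P i := by
  obtain ⟨p, hp⟩ := hG.exists_walk_length_eq_dist (deep g i n) y
  exact eq_deep_of_walk hS p rfl (hp ▸ h)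

/-- The walk never rises above height `D`, so each of its edges contributes a word of length at most
`2 ^ D`. -/
lemma inv_mul_mem_pow_of_cusped_walk (hS : IsCompatible P S) {D : ℕ} {x y : CuspedVertex Γ I}
    (p : (cuspedGraph P S).Walk x y) (hD : x.height + p.length ≤ D) :
    x.proj⁻¹ * y.proj ∈ (insert 1 S) ^ (2 ^ D * p.length) := by
  induction p with
  | nil => simp
  | @cons a b c H p ih =>
    rw [Walk.length_cons] at hD ⊢
    have h1 := height_le_of_adj H
    have h2 := pow_mem_pow_of_le (Nat.pow_le_pow_right two_pos (by omega : a.height ≤ D))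
      (inv_mul_mem_of_adj hS H)
    have h3 := ih (by omega)
    rw [mul_add, mul_one, add_comm, pow_add]
    exact Set.mem_mul.2 ⟨_, h2, _, h3, by group⟩

end Cusped

/-! ### Acyclicity of deep horoballs and finiteness near the base -/

section Cusped

open SimpleGraph Pointwise CuspedVertex

variable {Γ : Type u} {I : Type v} [Group Γ] {P : I → Subgroup Γ} {S : Set Γ}

/-- The part of height larger than `N` of the horoball on `g P_i`. -/
def deepCoset (P : I → Subgroup Γ) (N : ℕ) (g : Γ) (i : I) : Set (CuspedVertex Γ I) :=
  {x | ∃ h n, x = deep h i n ∧ N ≤ n ∧ g⁻¹ * h ∈ P i}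

/-- The Rips complex of the deep part of a horoball, with respect to the metric of the cusped graph,
is acyclic. -/
theorem exists_boundary_deepCoset (hS : IsCompatible P S) (hG : (cuspedGraph P S).Connected) {s : ℕ}
    (hs : ∀ a b c w : CuspedVertex Γ I, (cuspedGraph P S).dist a c + (cuspedGraph P S).dist b w ≤
      max ((cuspedGraph P S).dist a b + (cuspedGraph P S).dist c w)
        ((cuspedGraph P S).dist b c + (cuspedGraph P S).dist a w) + s)
    (N : ℕ) (g : Γ) (i : I) {n : ℕ} {c : TupleChain (CuspedVertex Γ I) (n + 1)}
    (hc : c ∈ cliqueChains (fun x y => (cuspedGraph P S).dist x y ≤ 2 * (s + 1))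
      (deepCoset P N g i) (n + 1))
    (h0 : tupleBoundary _ n c = 0) :
    ∃ b ∈ cliqueChains (fun x y => (cuspedGraph P S).dist x y ≤ 2 * (s + 1))
      (deepCoset P N g i) (n + 2), tupleBoundary _ (n + 1) b = c := by
  classical
  let F₀ : Finset (CuspedVertex Γ I) := c.support.biUnion fun y => Finset.univ.image y
  have hF₀ : ∀ y ∈ c.support, ∀ j, y j ∈ F₀ := fun y hy j =>
    Finset.mem_biUnion.2 ⟨y, hy, Finset.mem_image_of_mem _ (Finset.mem_univ j)⟩
  have hF₀' : ∀ x ∈ F₀, x ∈ deepCoset P N g i := by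
    intro x hx
    obtain ⟨y, hy, hxy⟩ := Finset.mem_biUnion.1 hx
    obtain ⟨j, -, rfl⟩ := Finset.mem_image.1 hxy
    exact (hc hy).1 j
  -- A level so high that the columns of all vertices of `c` have come within distance 1 of the
  -- column of `g`. The vertex `deep g i M` stands in for the point at infinity of the horoball.
  obtain ⟨M, hM⟩ : ∃ M, N ≤ M ∧ (∀ x ∈ F₀, x.height ≤ M) ∧
      ∀ x ∈ F₀, (cuspedGraph P S).dist (deep g i M) (deep x.proj i M) ≤ 1 := by
    refine (Filter.Eventually.and (Filter.eventually_ge_atTop N) (Filter.Eventually.and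
      ((Filter.eventually_all_finset F₀).2 fun x _ => Filter.eventually_ge_atTop x.height)
      ((Filter.eventually_all_finset F₀).2 fun x hx => ?_))).exists
    obtain ⟨h, n, rfl, -, hgh⟩ := hF₀' x hx
    exact eventually_dist_deep_le_one hS hgh
  obtain ⟨hNM, hMh, hMd⟩ := hM
  let T : Set (CuspedVertex Γ I) := {x | ∃ h n, x = deep h i n ∧ N ≤ n ∧ n ≤ M ∧ g⁻¹ * h ∈ P i ∧
    (cuspedGraph P S).dist (deep g i M) (deep h i M) ≤ 1}
  have hT : T ⊆ deepCoset P N g i := by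
    rintro _ ⟨h, n, rfl, h1, h2, h3, h4⟩
    exact ⟨h, n, rfl, h1, h3⟩
  -- Up to an error of 1, the distance to the apex is the difference of heights.
  have hdist : ∀ h n, n ≤ M → (cuspedGraph P S).dist (deep g i M) (deep h i M) ≤ 1 →
      (cuspedGraph P S).dist (deep h i n) (deep g i M) + n ≤ M + 1 ∧
        M ≤ (cuspedGraph P S).dist (deep h i n) (deep g i M) + n := by
    intro h n hn hd
    constructor
    · have h1 := hG.dist_triangle (u := deep h i n) (v := deep h i M) (w := deep g i M)
      have h2 := dist_deep_add_le (P := P) (S := S) h i n (M - n) hG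
      rw [Nat.add_sub_cancel' hn] at h2
      rw [dist_comm] at hd
      omega
    · have := height_le_add_dist hG (deep h i n) (deep g i M)
      simp only [height] at this
      omega
  have hcT : c ∈ cliqueChains (fun x y => (cuspedGraph P S).dist x y ≤ 2 * (s + 1)) T (n + 1) := by
    intro y hy
    refine ⟨fun j => ?_, (hc hy).2⟩
    have hj := hF₀ y hy j
    have h1 := hMh _ hj
    have h2 := hMd _ hj
    obtain ⟨h, n, hx, hn, hgh⟩ := hF₀' _ hj
    rw [hx] at h1 h2
    exact ⟨h, n, hx, hn, (Nat.le_succ n).trans h1, hgh, h2⟩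
  have hdis : ∀ F : Finset (CuspedVertex Γ I), (F : Set _) ⊆ T →
      (∃ p ∈ T, ∀ x ∈ F, (cuspedGraph P S).dist p x ≤ 2 * (s + 1)) ∨
      ∃ x ∈ F, ∃ x' ∈ T, M + 1 - x'.height < M + 1 - x.height ∧ ∀ y ∈ F,
        (cuspedGraph P S).dist x y ≤ 2 * (s + 1) → (cuspedGraph P S).dist x' y ≤ 2 * (s + 1) := by
    intro F hFT
    by_cases hF : ∀ x ∈ F, (cuspedGraph P S).dist (deep g i M) x ≤ 2 * (s + 1)
    · exact Or.inl ⟨deep g i M, ⟨g, M, rfl, hNM, le_rfl, by simp, by simp⟩, hF⟩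
    right
    push Not at hF
    obtain ⟨z, hz, hzp⟩ := hF
    obtain ⟨x, hx, hxmin⟩ := F.exists_min_image height ⟨z, hz⟩
    obtain ⟨hz', nz, rfl, -, hz1, -, hz2⟩ := hFT hz
    obtain ⟨h, k, rfl, hk1, hk2, hk3, hk4⟩ := hFT hx
    have h1 := hxmin _ hz
    simp only [height] at h1
    have h2 := (hdist _ _ hz1 hz2).1
    rw [dist_comm] at hzp
    -- The lowest vertex of `F` is pushed up by `s + 1`. The error 1 in `hdist` is absorbed because
    -- the scale is `2 * (s + 1)` rather than `2 * s + 1`.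
    refine ⟨_, hx, deep h i (k + (s + 1)),
      ⟨h, k + (s + 1), rfl, by omega, by omega, hk3, hk4⟩, ?_, fun y hy hxy => ?_⟩
    · simp only [height]
      omega
    · have h3 := hxmin _ hy
      obtain ⟨hy', l, rfl, -, hl1, -, hl2⟩ := hFT hy
      simp only [height] at h3
      have h4 := hs (deep h i (k + (s + 1))) (deep h i k) (deep hy' i l) (deep g i M)
      have h5 := hdist _ _ hl1 hl2
      have h6 := hdist _ _ hk2 hk4
      have h7 := hdist h (k + (s + 1)) (by omega) hk4
      have h8 := dist_deep_add_le (P := P) (S := S) h i k (s + 1) hG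
      rw [dist_comm] at h8
      omega
  obtain ⟨b, hb, hbc⟩ := exists_boundary_of_dismantlable (μ := fun x => M + 1 - x.height)
    (fun x => by simp) (fun x y h => by rwa [dist_comm]) hdis hcT h0
  exact ⟨b, mem_supported_of_subset hb fun y hy => ⟨fun j => hT (hy.1 j), hy.2⟩, hbc⟩

lemma finite_pow {T : Set Γ} (hT : T.Finite) (n : ℕ) : (T ^ n).Finite := by
  induction n with
  | zero => simp
  | succ n ih =>
    rw [pow_succ]
    exact ih.mul hT

/-- Simplices of the Rips complex that are not deep in a horoball have bounded dimension. -/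
theorem exists_card_bound [Finite I] (hS : IsCompatible P S) (hG : (cuspedGraph P S).Connected)
    (κ N : ℕ) : ∃ B : ℕ, ∀ (m : ℕ) (y : Fin m → CuspedVertex Γ I), Function.Injective y →
      (∀ j k, (cuspedGraph P S).dist (y j) (y k) ≤ κ) → (∃ j, (y j).height ≤ N) → m ≤ B := by
  let D := N + κ
  let W : Set Γ := (insert 1 S) ^ (2 ^ D * κ)
  have hW : W.Finite := finite_pow (hS.finite.insert 1) _
  let Z : Set (CuspedVertex Γ I) := {x | x.proj ∈ W ∧ x.height ≤ D}
  have hZ : Z.Finite := by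
    refine ((hW.image base).union ((hW.prod (Set.finite_univ.prod (Set.finite_Iio D))).image
      fun p : Γ × I × ℕ => deep p.1 p.2.1 p.2.2)).subset ?_
    rintro (g | ⟨g, i, n⟩) ⟨h1, h2⟩
    · exact Or.inl ⟨g, h1, rfl⟩
    · exact Or.inr ⟨(g, i, n), ⟨h1, Set.mem_univ _, h2⟩, rfl⟩
  refine ⟨Z.ncard, fun m y hy hclique ⟨j, hj⟩ => ?_⟩
  -- Translate the low vertex so that it lies over 1; the whole simplex then lies in the finite set
  -- `Z`.
  have := Set.ncard_le_ncard (s := Set.range fun k => (y j).proj⁻¹ • y k) (t := Z) ?_ hZ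
  · rwa [Set.ncard_range_of_injective
      (f := fun k => (y j).proj⁻¹ • y k) ((MulAction.injective _).comp hy), Nat.card_fin] at this
  · rintro _ ⟨k, rfl⟩
    have h1 := hclique j k
    have h2 := height_le_add_dist hG (y j) (y k)
    refine ⟨?_, ?_⟩
    · obtain ⟨p, hp⟩ := hG.exists_walk_length_eq_dist (y j) (y k)
      rw [proj_smul]
      exact pow_mem_pow_of_le (Nat.mul_le_mul_left _ (hp ▸ h1))
        (inv_mul_mem_pow_of_cusped_walk hS p (by omega))
    · rw [height_smul]
      omega

end Cusped

/-! ### Carriers for pairs -/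

section Pair

variable {Γ : Type u} {I : Type v} [Group Γ] {P : I → Subgroup Γ}

/-- The action of `Γ` on `Γ × I` by left translation of the first factor. -/
@[reducible] def leftTranslation (Γ : Type u) (I : Type v) [Group Γ] : MulAction Γ (Γ × I) where
  smul γ q := (γ * q.1, q.2)
  one_smul q := Prod.ext (one_mul q.1) rfl
  mul_smul γ₁ γ₂ q := Prod.ext (mul_assoc γ₁ γ₂ q.1) rfl

attribute [local instance] leftTranslation

lemma leftTranslation_free (γ : Γ) (q : Γ × I) (h : γ • q = q) : γ = 1 :=
  mul_eq_right.1 (congrArg Prod.fst h)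

/-- The coset `g P_i` in the copy `Γ × {i}` of `Γ`. -/
def cosetCopy (P : I → Subgroup Γ) (g : Γ) (i : I) : Set (Γ × I) :=
  {q | q.2 = i ∧ g⁻¹ * q.1 ∈ P i}

lemma isPeripheral_iff {k : ℕ} (x : Fin (k + 1) → Γ × I) :
    IsPeripheral P x ↔ ∃ g i, ∀ j, x j ∈ cosetCopy P g i := by
  constructor
  · rintro ⟨i, h1, h2⟩
    exact ⟨(x 0).1, i, fun j => ⟨h1 j, h2 j⟩⟩
  · rintro ⟨g, i, h⟩
    refine ⟨i, fun j => (h j).1, fun j => ?_⟩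
    have := (P i).mul_mem ((P i).inv_mem (h 0).2) (h j).2
    simpa [mul_assoc] using this

/-- Turns membership in St' into a condition on supports, matching the form of the carriers. -/
lemma stPrime_eq_supported (P : I → Subgroup Γ) (k : ℕ) :
    stPrime P k = Finsupp.supported ℝ ℝ {x | IsPeripheral P x} := by
  rw [Finsupp.supported_eq_span_single, stPrime]
  congr 1
  ext c
  constructor
  · rintro ⟨x, hx, rfl⟩
    exact ⟨x, hx, rfl⟩
  · rintro ⟨x, hx, rfl⟩
    exact ⟨x, hx, rfl⟩

/-- The carrier of a pair: the simplices of the clique complex of `R`, which for the tuples of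
elements of `g P_i × {i}` have to lie in `A g i`. -/
def pairCarrier {Y : Type*} (P : I → Subgroup Γ) (R : Y → Y → Prop) (A : Γ → I → Set Y) (m : ℕ)
    (x : Fin m → Γ × I) (n : ℕ) : Submodule ℝ (TupleChain Y n) :=
  Finsupp.supported ℝ ℝ {y | y ∈ cliqueTuples R Set.univ n ∧
    ∀ g i, (∀ j, x j ∈ cosetCopy P g i) → ∀ j, y j ∈ A g i}

/-- A nonempty peripheral tuple determines its index and its coset, so its carrier is the clique
complex of a single `A g i`; any other nonempty tuple is carried by the whole clique complex. -/
lemma isAcyclicCarrier_pairCarrier {Y : Type*} [MulAction Γ Y] {R : Y → Y → Prop}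
    {A : Γ → I → Set Y} (hR : ∀ (γ : Γ) x y, R x y → R (γ • x) (γ • y))
    (hA : ∀ (γ : Γ) g i, ∀ x ∈ A g i, γ • x ∈ A (γ * g) i)
    (hA' : ∀ g h i, g⁻¹ * h ∈ P i → A g i ⊆ A h i)
    (hRb : ∀ (n : ℕ) (c : TupleChain Y (n + 1)), c ∈ cliqueChains R Set.univ (n + 1) →
      tupleBoundary Y n c = 0 → ∃ b ∈ cliqueChains R Set.univ (n + 2),
        tupleBoundary Y (n + 1) b = c)
    (hAb : ∀ g i (n : ℕ) (c : TupleChain Y (n + 1)), c ∈ cliqueChains R (A g i) (n + 1) →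
      tupleBoundary Y n c = 0 → ∃ b ∈ cliqueChains R (A g i) (n + 2),
        tupleBoundary Y (n + 1) b = c) :
    IsAcyclicCarrier Γ (pairCarrier P R A) where
  mono m x j n := Finsupp.supported_mono fun y hy => ⟨hy.1, fun g i h => hy.2 g i fun _ => h _⟩
  equivariant γ m x n c hc := by
    refine mem_of_mem_supported (fun y hy => ?_) hc
    rw [tupleRep_single]
    refine Finsupp.single_mem_supported _ _
      ⟨⟨fun _ => trivial, fun j k => hR γ _ _ (hy.1.2 j k)⟩, fun g i h j => ?_⟩
    have h1 : ∀ j, x j ∈ cosetCopy P (γ⁻¹ * g) i := fun j => ⟨(h j).1, by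
      have := (h j).2
      change g⁻¹ * (γ * (x j).1) ∈ P i at this
      simpa [mul_assoc] using this⟩
    simpa using hA γ _ _ _ (hy.2 _ _ h1 j)
  exists_boundary m x n c hc h0 := by
    by_cases hx : ∃ g i, ∀ j, x j ∈ cosetCopy P g i
    · obtain ⟨g, i, hx⟩ := hx
      obtain ⟨b, hb, hbc⟩ := hAb g i n c (mem_supported_of_subset hc
        fun y hy => ⟨hy.2 g i hx, hy.1.2⟩) h0
      refine ⟨b, mem_supported_of_subset hb fun y hy => ⟨⟨fun _ => trivial, hy.2⟩, ?_⟩, hbc⟩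
      intro g' i' h j
      obtain rfl : i = i' := (hx 0).1.symm.trans (h 0).1
      refine hA' g g' i ?_ (hy.1 j)
      have := (P i).mul_mem (hx 0).2 ((P i).inv_mem (h 0).2)
      simpa [mul_assoc] using this
    · obtain ⟨b, hb, hbc⟩ := hRb n c (mem_supported_of_subset hc fun y hy => hy.1) h0
      exact ⟨b, mem_supported_of_subset hb fun y hy => ⟨hy, fun g i h => (hx ⟨g, i, h⟩).elim⟩, hbc⟩

/-- The carrier of the standard complex of a pair is acyclic. -/
lemma isAcyclicCarrier_standard [Nonempty I] (P : I → Subgroup Γ) :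
    IsAcyclicCarrier Γ (pairCarrier P (fun _ _ => True) (cosetCopy P)) := by
  have key : ∀ (T : Set (Γ × I)) (p : Γ × I), p ∈ T → ∀ (n : ℕ) (c : TupleChain (Γ × I) (n + 1)),
      c ∈ cliqueChains (fun _ _ => True) T (n + 1) → tupleBoundary _ n c = 0 →
        ∃ b ∈ cliqueChains (fun _ _ => True) T (n + 2), tupleBoundary _ (n + 1) b = c :=
    fun T p hp n c hc h0 => exists_boundary_of_dismantlable (μ := fun _ => 0) (fun _ => trivial)
      (fun _ _ _ => trivial) (fun F _ => Or.inl ⟨p, hp, fun _ _ => trivial⟩) hc h0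
  refine isAcyclicCarrier_pairCarrier (fun _ _ _ _ => trivial) (fun γ g i q hq => ⟨hq.1, ?_⟩)
    (fun g h i hgh q hq => ⟨hq.1, ?_⟩) (key _ (1, Classical.arbitrary I) trivial)
    (fun g i => key _ (g, i) ⟨rfl, by simp⟩)
  · change (γ * g)⁻¹ * (γ * q.1) ∈ P i
    simpa [mul_assoc] using hq.2
  · have := (P i).mul_mem ((P i).inv_mem hgh) hq.2
    simpa [mul_assoc] using this

/-- For a relatively hyperbolic pair, the identity of the standard complex is homotopic to a map
that vanishes in high degrees modulo the peripheral subcomplex. -/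
theorem IsRelativelyHyperbolic.exists_homotopy [Finite I] [Nonempty I] (P : I → Subgroup Γ)
    (hP : IsRelativelyHyperbolic P) : ∃ (B : ℕ)
      (h : ∀ k, Chain (Γ × I) k →ₗ[ℝ] Chain (Γ × I) (k + 1)),
      (∀ k γ c, h k (stRep Γ I k γ c) = stRep Γ I (k + 1) γ (h k c)) ∧
      (∀ k, stPrime P k ≤ (stPrime P (k + 1)).comap (h k)) ∧
      ∀ k, B ≤ k → ∀ c, boundary (Γ × I) (k + 1) (h (k + 1) c) + c + h k (boundary (Γ × I) k c) ∈
        stPrime P (k + 1) := by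
  obtain ⟨S, hS, hyp⟩ := hP
  have hG := hyp.1
  obtain ⟨s, hs⟩ := hyp.exists_four_point
  set N := 2 * (s + 1) with hN
  let R : CuspedVertex Γ I → CuspedVertex Γ I → Prop := fun x y => (cuspedGraph P S).dist x y ≤ N
  obtain ⟨B, hB⟩ := exists_card_bound hS hG N N
  have hK : IsAcyclicCarrier Γ (pairCarrier P R (deepCoset P N)) := by
    refine isAcyclicCarrier_pairCarrier (fun γ x y h => ?_) ?_ ?_
      (fun n c => exists_boundary_of_four_point hG hs)
      (fun g i n c => exists_boundary_deepCoset hS hG hs N g i)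
    · simpa only [R, dist_smul hG] using h
    · rintro γ g i _ ⟨h, n, rfl, hn, hgh⟩
      exact ⟨γ * h, n, rfl, hn, by simpa [mul_assoc] using hgh⟩
    · rintro g g' i hgg' _ ⟨h, n, rfl, hn, hgh⟩
      refine ⟨h, n, rfl, hn, ?_⟩
      have := (P i).mul_mem ((P i).inv_mem hgg') hgh
      simpa [mul_assoc] using this
  -- Height `N + 1`, so entries from a coset start in the deep part of its horoball. The map back,
  -- `ψ`, forgets the height and sends the base to one fixed copy of Γ, which keeps it equivariant.
  let f : Γ × I → CuspedVertex Γ I := fun q => CuspedVertex.deep q.1 q.2 N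
  let ψ : CuspedVertex Γ I → Γ × I := fun x => match x with
    | CuspedVertex.base g => (g, Classical.arbitrary I)
    | CuspedVertex.deep g i _ => (g, i)
  have hψ : ∀ (γ : Γ) x, ψ (γ • x) = γ • ψ x := fun γ x => by cases x <;> rfl
  obtain ⟨φ, hφ0, hφb, hφe, hφK⟩ := hK.exists_chainMap leftTranslation_free (f := f)
    (fun γ q => rfl) (fun x => Finsupp.single_mem_supported _ _
      ⟨⟨fun _ => trivial, fun j k => by simp [R, Subsingleton.elim j k]⟩,
        fun g i h j => ⟨(x j).1, N, by simp [f, (h j).1], le_rfl, (h j).2⟩⟩)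
  let θ : ∀ n, TupleChain (Γ × I) n →ₗ[ℝ] TupleChain (Γ × I) n := fun n =>
    tupleMap ψ n ∘ₗ tupleAlt _ n ∘ₗ φ n
  have hθ : ∀ n c, θ n c = tupleMap ψ n (tupleAlt _ n (φ n c)) := fun _ _ => rfl
  obtain ⟨h, hhe, hhK, hhb⟩ := (isAcyclicCarrier_standard P).exists_homotopy leftTranslation_free
    (t := fun n => θ n - LinearMap.id)
    (tupleChain_hom_ext fun x => by
      rw [LinearMap.sub_apply, hθ, hφ0, tupleAlt_zero, LinearMap.id_apply, tupleMap_tupleMap,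
        tupleMap_single]
      simp [Subsingleton.elim _ x])
    (fun n c => by
      simp only [LinearMap.sub_apply, hθ, LinearMap.id_apply, map_sub, tupleBoundary_tupleMap,
        tupleBoundary_tupleAlt, hφb])
    (fun n γ c => by
      have h1 : ∀ c, tupleAlt (CuspedVertex Γ I) n (tupleRep Γ _ n γ c) =
          tupleRep Γ _ n γ (tupleAlt _ n c) := tupleAlt_tupleMap _
      simp only [LinearMap.sub_apply, hθ, LinearMap.id_apply, map_sub, hφe n γ, h1,
        isTupleEquivariant_tupleMap hψ n γ])
    (fun n x => by
      refine Submodule.sub_mem _ ?_ (Finsupp.single_mem_supported _ _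
        ⟨⟨fun _ => trivial, fun _ _ => trivial⟩, fun g i h => h⟩)
      refine mem_of_mem_supported (F := tupleMap ψ (n + 1) ∘ₗ tupleAlt _ (n + 1)) (fun y hy => ?_)
        (hφK n x)
      refine tupleAlt_single_mem (F := tupleMap ψ (n + 1)) fun σ => ?_
      rw [tupleMap_single]
      refine Finsupp.single_mem_supported _ _ ⟨⟨fun _ => trivial, fun _ _ => trivial⟩,
        fun g i hx j => ?_⟩
      obtain ⟨k, l, hk, -, hgk⟩ := hy.2 g i hx (σ j)
      simp only [Function.comp_apply, hk]
      exact ⟨rfl, hgk⟩)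
  have hθ' : ∀ k, B ≤ k → ∀ c, θ (k + 1) c ∈ stPrime P k := by
    intro k hk c
    refine mem_of_mem_supported (s := Set.univ) (fun x _ => ?_) (by simp)
    refine mem_of_mem_supported (F := tupleMap ψ (k + 1) ∘ₗ tupleAlt _ (k + 1)) (fun y hy => ?_)
      (hφK k x)
    rw [LinearMap.comp_apply]
    by_cases hinj : Function.Injective y
    -- A clique with `k + 1 > B` distinct vertices has no vertex of height at most `N`.
    · have hdeep : ∀ j, N < (y j).height := by
        intro j
        by_contra hj
        have := hB _ y hinj hy.1.2 ⟨j, not_lt.1 hj⟩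
        omega
      obtain ⟨g, i, n, h0⟩ : ∃ g i n, y 0 = CuspedVertex.deep g i n := by
        have := hdeep 0
        cases hy0 : y 0 with
        | base g => simp [hy0, CuspedVertex.height] at this
        | deep g i n => exact ⟨g, i, n, rfl⟩
      have hn := hdeep 0
      rw [h0] at hn
      have hy' : ∀ j, ψ (y j) ∈ cosetCopy P g i := by
        intro j
        have h1 : (cuspedGraph P S).dist (y 0) (y j) ≤ N := hy.1.2 0 j
        rw [h0] at h1
        -- The vertex `y 0` has height `n + 1 > N`, so `N ≤ n` and all vertices within distance `N`
        -- lie in its horoball.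
        obtain ⟨h, m, hj, hgh⟩ := eq_deep_of_dist_le hS hG (h1.trans (Nat.lt_succ_iff.1 hn))
        rw [hj]
        exact ⟨rfl, hgh⟩
      refine tupleAlt_single_mem (F := tupleMap ψ (k + 1)) fun σ => ?_
      rw [tupleMap_single, stPrime_eq_supported]
      exact Finsupp.single_mem_supported _ _
        ((isPeripheral_iff _).2 ⟨g, i, fun j => hy' (σ j)⟩)
    · rw [tupleAlt_single_of_not_injective hinj, map_zero]
      exact Submodule.zero_mem _
  refine ⟨B, fun k => h (k + 1), fun k γ c => hhe (k + 1) γ c, fun k c hc => ?_, fun k hk c => ?_⟩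
  · rw [stPrime_eq_supported] at hc
    refine mem_of_mem_supported (F := h (k + 1)) (N := stPrime P (k + 1)) (fun x hx => ?_) hc
    obtain ⟨g, i, hx⟩ := (isPeripheral_iff x).1 hx
    rw [stPrime_eq_supported]
    exact Finsupp.supported_mono (fun y hy => (isPeripheral_iff y).2 ⟨g, i, hy.2 g i hx⟩)
      (hhK (k + 1) x)
  · have h1 := hhb (k + 1) c
    have h2 := hθ' (k + 1) (by omega) c
    rw [LinearMap.sub_apply, LinearMap.id_apply] at h1
    rw [← tupleBoundary_succ, ← tupleBoundary_succ, h1]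
    convert h2 using 1
    abel

end Pair

end RelHyp

/-! ### Vanishing of relative cohomology -/

theorem mainTheorem3 {Γ : Type u} {I : Type v} [Group Γ] [Finite I] [Nonempty I]
    (P : I → Subgroup Γ) (hP : RelHyp.IsRelativelyHyperbolic P) :
    ∃ n : ℕ, ∀ m : ℕ, n < m →
      ∀ (V : Type w) [NormedAddCommGroup V] [NormedSpace ℝ V] (ρ : Representation ℝ Γ V),
        RelHyp.IsBoundedModule ρ → Subsingleton (RelHyp.RelCohomology P ρ m) := by
  obtain ⟨B, h, hhe, hhP, hhb⟩ := hP.exists_homotopy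
  refine ⟨B, fun m hm V _ _ ρ _ => ?_⟩
  obtain ⟨k, rfl⟩ : ∃ k, m = k + 1 := ⟨m - 1, by omega⟩
  rw [Submodule.Quotient.subsingleton_iff, eq_top_iff]
  rintro ⟨f, hf⟩ -
  have hf0 : ∀ c, f (Submodule.Quotient.mk (RelHyp.boundary (Γ × I) (k + 1) c)) = 0 := fun c =>
    congrArg (fun F : RelHyp.RelCochain P ρ (k + 2) => F (Submodule.Quotient.mk c))
      (LinearMap.mem_ker.1 hf)
  -- Applying `f` to ∂h + id + h∂ = 0 on St^rel and using f∂ = 0 gives f = -f h∂. Thus -f h is a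
  -- primitive.
  refine ⟨⟨-(f.toLinearMap ∘ₗ Submodule.mapQ _ _ (h k) (hhP k)), fun γ => ?_⟩, ?_⟩
  · refine Submodule.linearMap_qext _ (LinearMap.ext fun c => ?_)
    have h1 := LinearMap.congr_fun (f.isIntertwining' γ) (Submodule.Quotient.mk (h k c))
    simp only [LinearMap.comp_apply] at h1
    simp only [LinearMap.comp_apply, LinearMap.neg_apply, map_neg, neg_inj, Submodule.mkQ_apply,
      Submodule.mapQ_apply]
    rw [← h1]
    change f.toLinearMap (Submodule.Quotient.mk (h k (RelHyp.stRep Γ I k γ c))) =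
      f.toLinearMap (Submodule.Quotient.mk (RelHyp.stRep Γ I (k + 1) γ (h k c)))
    rw [hhe]
  · refine Representation.IntertwiningMap.ext (Submodule.linearMap_qext _ (LinearMap.ext fun c => ?_))
    have h1 := (Submodule.Quotient.mk_eq_zero _).2 (hhb k (by omega) c)
    have h2 := congrArg f.toLinearMap h1
    rw [Submodule.Quotient.mk_add, Submodule.Quotient.mk_add, map_add, map_add, map_zero] at h2
    have h3 : f.toLinearMap (Submodule.Quotient.mk
      (RelHyp.boundary (Γ × I) (k + 1) (h (k + 1) c))) = 0 := hf0 _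
    rw [h3, zero_add] at h2
    exact (eq_neg_of_add_eq_zero_left h2).symm
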